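/- **Setting.** Let $k_i,c_i>0$ ($i=1,2,3$), $\rho,\ell_1,\ell_2>0$ and $B>C>D$ be real numbers, put $\alpha_i=k_i/(\rho c_i)$, $\delta_i=\rho\ell_i$, and assume $\alpha_2>\alpha_3$. Consider temperatures $\Phi_1,\Phi_2,\Phi_3$ and free boundaries $y_1,y_2$, continuous on $[0,\infty)$, with $y_1(0)=y_2(0)=0$ and $0<y_2(t)<y_1(t)$ for $t>0$, such that for $t>0$ - $\partial_t\Phi_3=\alpha_3\partial_{xx}\Phi_3$ for $0<x<y_2(t)$, $\partial_t\Phi_2=\alpha_2\partial_{xx}\Phi_2$ for $y_2(t)<x<y_1(t)$, $\partial_t\Phi_1=\alpha_1\partial_{xx}\Phi_1$ for $x>y_1(t)$, each $\Phi_i$ being continuous up to the boundary $x=0$, $x=y_2(t)$, $x=y_1(t)$ of its region; - $\Phi_3(y_2(t),t)=\Phi_2(y_2(t),t)=B$, $\ \Phi_2(y_1(t),t)=\Phi_1(y_1(t),t)=C$; - $\lim_{s\to0^+}\Phi_1(x,s)=D$ for $x>0$, and $\lim_{x\to\infty}\Phi_1(x,t)=D$; - $k_2\partial_x\Phi_2(y_2(t),t)-k_3\partial_x\Phi_3(y_2(t),t)=\delta_2\dot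 y_2(t)$ and $k_1\partial_x\Phi_1(y_1(t),t)-k_2\partial_x\Phi_2(y_1(t),t)=\delta_1\dot y_1(t)$, with one-sided space derivatives. Problem **(P1)** adds the Robin condition $k_3\,\partial_x\Phi_3(0,t)=\frac{h_0}{\sqrt t}\left(\Phi_3(0,t)-A_\infty\right)$, $t>0$; problem **(P2)** adds instead the Dirichlet condition $\Phi_3(0,t)=A$, $t>0$. Solutions are understood to be of similarity type: each $\Phi_i$ is a function of $x/(2\sqrt{\alpha_it})$ in its region and $y_i(t)$ is a constant multiple of $\sqrt{\alpha_1t}$. "The solution" means that there is exactly one such solution (temperatures being compared on the closures of their regions for $t>0$). With $\operatorname{erf}(x)=\frac{2}{\sqrt\pi}\int_0^xe^{-u^2}du$, $\operatorname{erfc}=1-\operatorname{erf}$, $\mathrm{Ste}_1=\frac{c_1(C-D)}{\ell_1}$ and $\mathrm{Ste}_2=\frac{c_2(B-C)}{\ell_2}$, put $$\varphi(z)=z+\tfrac{\mathrm{Ste}_1}{\sqrt\pi}\tfrac{e^{-z^2}}{\operatorname{erfc}(z)},\qquad H(z)=\operatorname{erf}\!\left(z\sqrt{\tfrac{\alpha_1}{\alpha_2}}\right)-\tfrac{\mathrm{Ste}_2}{\sqrt\pi}\tfrac{\ell_2}{\ell_1}\sqrt{\tfrac{k_2c_1}{k_1c_2}}\,\tfrac{e^{-z^2\alpha_1/\alpha_2}}{\varphi(z)},\qquad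 Q(z)=\tfrac{\ell_1}{\ell_2}\varphi(z)e^{z^2\alpha_1/\alpha_2},$$ $$T(z)=\tfrac{\mathrm{Ste}_2}{\sqrt\pi\,c_2}\tfrac{A_\infty-B}{B-C}\sqrt{\tfrac{k_3c_1c_3}{k_1}}\;\tfrac{e^{-z^2\alpha_1(1/\alpha_3-1/\alpha_2)}}{\frac{k_3}{h_0\sqrt{\pi\alpha_3}}+\operatorname{erf}\left(z\sqrt{\alpha_1/\alpha_3}\right)}-z\,e^{z^2\alpha_1/\alpha_2},$$ $$V(z)=\tfrac{A-B}{\ell_2}\sqrt{\tfrac{c_1c_3k_3}{\pi k_1}}\;\tfrac{e^{-z^2(\alpha_1/\alpha_3-\alpha_1/\alpha_2)}}{\operatorname{erf}\left(z\sqrt{\alpha_1/\alpha_3}\right)}-z\,e^{z^2\alpha_1/\alpha_2},\qquad \sigma(z)=\sqrt{\tfrac{\alpha_2}{\alpha_1}}\operatorname{erf}^{-1}(H(z)).$$ **Theorem.** $H$ has exactly one positive zero $z_0$, and the following hold. (a) Let $A_\infty>B$ and $$h_0>h_2:=\tfrac{B-C}{A_\infty-B}\sqrt{\tfrac{k_2k_3c_2}{\pi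 c_3\alpha_3}}\;\frac{1}{\operatorname{erf}\left(z_0\sqrt{\alpha_1/\alpha_2}\right)}.$$ The equation $Q(z)=T(\sigma(z))$ has exactly one root $\xi_1>z_0$. Put $\xi_2=\sigma(\xi_1)$ and $$A=\frac{\frac{Bk_3}{h_0\sqrt{\pi\alpha_3}}+A_\infty\operatorname{erf}\left(\xi_2\sqrt{\alpha_1/\alpha_3}\right)}{\frac{k_3}{h_0\sqrt{\pi\alpha_3}}+\operatorname{erf}\left(\xi_2\sqrt{\alpha_1/\alpha_3}\right)}.$$ If $A>B$, then the solution of (P2) with this $A$ coincides with the solution of (P1). It is given by $y_i(t)=2\xi_i\sqrt{\alpha_1t}$ and $$\Phi_3=\tfrac{\frac{Bk_3}{h_0\sqrt{\pi\alpha_3}}+A_\infty\operatorname{erf}\left(\xi_2\sqrt{\frac{\alpha_1}{\alpha_3}}\right)-(A_\infty-B)\operatorname{erf}\left(\frac{x}{2\sqrt{\alpha_3t}}\right)}{\frac{k_3}{h_0\sqrt{\pi\alpha_3}}+\operatorname{erf}\left(\xi_2\sqrt{\frac{\alpha_1}{\alpha_3}}\right)},\qquad \Phi_2=\tfrac{-C\operatorname{erf}\left(\xi_2\sqrt{\frac{\alpha_1}{\alpha_2}}\right)+B\operatorname{erf}\left(\xi_1\sqrt{\frac{\alpha_1}{\alpha_2}}\right)-(B-C)\operatorname{erf}\left(\frac{x}{2\sqrt{\alpha_2t}}\right)}{\operatorname{erf}\left(\xi_1\sqrt{\frac{\alpha_1}{\alpha_2}}\right)-\operatorname{erf}\left(\xi_2\sqrt{\frac{\alpha_1}{\alpha_2}}\right)},$$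 $$\Phi_1=\tfrac{C\left(1-\operatorname{erf}\left(\frac{x}{2\sqrt{\alpha_1t}}\right)\right)+D\left(\operatorname{erf}\left(\frac{x}{2\sqrt{\alpha_1t}}\right)-\operatorname{erf}(\xi_1)\right)}{\operatorname{erfc}(\xi_1)}.$$ (b) Let $A>B$. The equation $Q(z)=V(\sigma(z))$ has exactly one root $\mu_1>z_0$. Put $\mu_2=\sigma(\mu_1)$. If $A_\infty>A$ and $$\frac{A-B}{(A_\infty-A)\operatorname{erf}\left(\mu_2\sqrt{\alpha_1/\alpha_3}\right)}>\frac{B-C}{A_\infty-B}\sqrt{\tfrac{k_2c_2}{k_3c_3}}\;\frac{1}{\operatorname{erf}\left(z_0\sqrt{\alpha_1/\alpha_2}\right)},$$ then the solution of (P1) with $$h_0=\frac{k_3}{\sqrt{\alpha_3\pi}}\,\frac{A-B}{A_\infty-A}\,\frac{1}{\operatorname{erf}\left(\mu_2\sqrt{\alpha_1/\alpha_3}\right)}$$ coincides with the solution of (P2). It is given by $y_i(t)=2\mu_i\sqrt{\alpha_1t}$ and $$\Phi_3=A\,\tfrac{\operatorname{erf}\left(\mu_2\sqrt{\frac{\alpha_1}{\alpha_3}}\right)-\operatorname{erf}\left(\frac{x}{2\sqrt{\alpha_3t}}\right)}{\operatorname{erf}\left(\mu_2\sqrt{\frac{\alpha_1}{\alpha_3}}\right)}+B\,\tfrac{\operatorname{erf}\left(\frac{x}{2\sqrt{\alpha_3t}}\right)}{\operatorname{erf}\left(\mu_2\sqrt{\frac{\alpha_1}{\alpha_3}}\right)},\qquad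 \Phi_2=\tfrac{(C-B)\operatorname{erf}\left(\frac{x}{2\sqrt{\alpha_2t}}\right)-C\operatorname{erf}\left(\mu_2\sqrt{\frac{\alpha_1}{\alpha_2}}\right)+B\operatorname{erf}\left(\mu_1\sqrt{\frac{\alpha_1}{\alpha_2}}\right)}{\operatorname{erf}\left(\mu_1\sqrt{\frac{\alpha_1}{\alpha_2}}\right)-\operatorname{erf}\left(\mu_2\sqrt{\frac{\alpha_1}{\alpha_2}}\right)},$$ $$\Phi_1=D+(C-D)\,\tfrac{\operatorname{erfc}\left(\frac{x}{2\sqrt{\alpha_1t}}\right)}{\operatorname{erfc}(\mu_1)}.$$ -/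

import Mathlib

open scoped Real Topology

noncomputable section

namespace ThreePhase

/-! ### The error function -/

def erf (x : ℝ) : ℝ := 2 / √π * ∫ u in (0 : ℝ)..x, Real.exp (-u ^ 2)

def erfc (x : ℝ) : ℝ := 1 - erf x

/-- The inverse of `erf`; it is only evaluated on values in the range `(-1, 1)` of the injective
function `erf`. -/
def erfInv (y : ℝ) : ℝ := Function.invFun erf y

/-! ### Physical data -/

/-- Conductivities `k`, specific heats `c`, density `ρ`, latent heats per unit mass `ℓ`,
phase change temperatures `B`, `C` and initial temperature `D`, with the standing assumptions. -/
structure Data where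
  (k₁ k₂ k₃ c₁ c₂ c₃ ρ ℓ₁ ℓ₂ B C D : ℝ)
  k₁_pos : 0 < k₁
  k₂_pos : 0 < k₂
  k₃_pos : 0 < k₃
  c₁_pos : 0 < c₁
  c₂_pos : 0 < c₂
  c₃_pos : 0 < c₃
  ρ_pos : 0 < ρ
  ℓ₁_pos : 0 < ℓ₁
  ℓ₂_pos : 0 < ℓ₂
  C_lt_B : C < B
  D_lt_C : D < C
  diffusivity_lt : k₃ / (ρ * c₃) < k₂ / (ρ * c₂)

/-- Temperatures of the three phases, as functions of `x` and `t`, and the two free boundaries.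
Only the values on the closure of the respective phase (for `t > 0`) matter. -/
structure Candidate where
  (Φ₁ Φ₂ Φ₃ : ℝ → ℝ → ℝ)
  (y₁ y₂ : ℝ → ℝ)

/-- `Φ` satisfies `∂Φ/∂t = a ∂²Φ/∂x²` in the classical sense at `(x, t)`. -/
def HeatAt (a : ℝ) (Φ : ℝ → ℝ → ℝ) (x t : ℝ) : Prop :=
  DifferentiableAt ℝ (fun s => Φ x s) t ∧
  DifferentiableAt ℝ (fun z => Φ z t) x ∧
  DifferentiableAt ℝ (deriv fun z => Φ z t) x ∧
  deriv (fun s => Φ x s) t = a * deriv (deriv fun z => Φ z t) x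

/-- Two candidates are the same triple of temperatures and pair of free boundaries. -/
def Candidate.Coincide (S T : Candidate) : Prop :=
  (∀ t, 0 ≤ t → S.y₁ t = T.y₁ t ∧ S.y₂ t = T.y₂ t) ∧
  ∀ t, 0 < t →
    (∀ x, 0 ≤ x → x ≤ S.y₂ t → S.Φ₃ x t = T.Φ₃ x t) ∧
    (∀ x, S.y₂ t ≤ x → x ≤ S.y₁ t → S.Φ₂ x t = T.Φ₂ x t) ∧
    (∀ x, S.y₁ t ≤ x → S.Φ₁ x t = T.Φ₁ x t)

namespace Data

variable (M : Data)

/-- Thermal diffusivities. -/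
def α₁ : ℝ := M.k₁ / (M.ρ * M.c₁)
def α₂ : ℝ := M.k₂ / (M.ρ * M.c₂)
def α₃ : ℝ := M.k₃ / (M.ρ * M.c₃)

/-- Latent heats per unit volume. -/
def δ₁ : ℝ := M.ρ * M.ℓ₁
def δ₂ : ℝ := M.ρ * M.ℓ₂

/-- Stefan numbers. -/
def Ste₁ : ℝ := M.c₁ * (M.C - M.D) / M.ℓ₁
def Ste₂ : ℝ := M.c₂ * (M.B - M.C) / M.ℓ₂

/-! ### The free boundary problems -/

/-- Everything in the three-phase Stefan problem except the condition at the fixed face `x = 0`.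
Values of the temperatures on the boundary of a phase are taken by continuity, space derivatives
there are one-sided, and the initial condition is the limit `t → 0⁺`. -/
structure IsStefan (S : Candidate) : Prop where
  ordered : ∀ t, 0 < t → 0 < S.y₂ t ∧ S.y₂ t < S.y₁ t
  cont_y₁ : ContinuousOn S.y₁ (Set.Ici 0)
  cont_y₂ : ContinuousOn S.y₂ (Set.Ici 0)
  start : S.y₁ 0 = 0 ∧ S.y₂ 0 = 0
  cont_Φ₃ : ContinuousOn (fun p : ℝ × ℝ => S.Φ₃ p.1 p.2)
    {p | 0 < p.2 ∧ 0 ≤ p.1 ∧ p.1 ≤ S.y₂ p.2}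
  cont_Φ₂ : ContinuousOn (fun p : ℝ × ℝ => S.Φ₂ p.1 p.2)
    {p | 0 < p.2 ∧ S.y₂ p.2 ≤ p.1 ∧ p.1 ≤ S.y₁ p.2}
  cont_Φ₁ : ContinuousOn (fun p : ℝ × ℝ => S.Φ₁ p.1 p.2)
    {p | 0 < p.2 ∧ S.y₁ p.2 ≤ p.1}
  heat₃ : ∀ x t, 0 < t → 0 < x → x < S.y₂ t → HeatAt M.α₃ S.Φ₃ x t
  heat₂ : ∀ x t, 0 < t → S.y₂ t < x → x < S.y₁ t → HeatAt M.α₂ S.Φ₂ x t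
  heat₁ : ∀ x t, 0 < t → S.y₁ t < x → HeatAt M.α₁ S.Φ₁ x t
  temp_y₂ : ∀ t, 0 < t → S.Φ₃ (S.y₂ t) t = M.B ∧ S.Φ₂ (S.y₂ t) t = M.B
  temp_y₁ : ∀ t, 0 < t → S.Φ₂ (S.y₁ t) t = M.C ∧ S.Φ₁ (S.y₁ t) t = M.C
  initial : ∀ x, 0 < x → Filter.Tendsto (fun t => S.Φ₁ x t) (𝓝[>] 0) (𝓝 M.D)
  infinity : ∀ t, 0 < t → Filter.Tendsto (fun x => S.Φ₁ x t) Filter.atTop (𝓝 M.D)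
  stefan₂ : ∀ t, 0 < t → ∃ p₂ p₃ v : ℝ,
    HasDerivWithinAt (fun x => S.Φ₂ x t) p₂ (Set.Icc (S.y₂ t) (S.y₁ t)) (S.y₂ t) ∧
    HasDerivWithinAt (fun x => S.Φ₃ x t) p₃ (Set.Icc 0 (S.y₂ t)) (S.y₂ t) ∧
    HasDerivAt S.y₂ v t ∧
    M.k₂ * p₂ - M.k₃ * p₃ = M.δ₂ * v
  stefan₁ : ∀ t, 0 < t → ∃ p₁ p₂ v : ℝ,
    HasDerivWithinAt (fun x => S.Φ₁ x t) p₁ (Set.Ici (S.y₁ t)) (S.y₁ t) ∧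
    HasDerivWithinAt (fun x => S.Φ₂ x t) p₂ (Set.Icc (S.y₂ t) (S.y₁ t)) (S.y₁ t) ∧
    HasDerivAt S.y₁ v t ∧
    M.k₁ * p₁ - M.k₂ * p₂ = M.δ₁ * v

/-- The convective condition `k₃ ∂Φ₃/∂x(0,t) = h₀ / √t (Φ₃(0,t) - A∞)`. -/
def RobinCondition (h₀ Ainf : ℝ) (S : Candidate) : Prop :=
  ∀ t, 0 < t → ∃ p : ℝ,
    HasDerivWithinAt (fun x => S.Φ₃ x t) p (Set.Icc 0 (S.y₂ t)) 0 ∧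
    M.k₃ * p = h₀ / √t * (S.Φ₃ 0 t - Ainf)

/-- The temperature condition `Φ₃(0,t) = A`. -/
def DirichletCondition (A : ℝ) (S : Candidate) : Prop :=
  ∀ t, 0 < t → S.Φ₃ 0 t = A

/-- Similarity type: each temperature is a function of `x / (2 √(αᵢ t))` in its phase and each
free boundary is a constant multiple of `√(α₁ t)`. -/
def IsSimilarity (S : Candidate) : Prop :=
  ∃ (f₁ f₂ f₃ : ℝ → ℝ) (ξ₁ ξ₂ : ℝ), ∀ t, 0 < t →
    S.y₁ t = 2 * ξ₁ * √(M.α₁ * t) ∧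
    S.y₂ t = 2 * ξ₂ * √(M.α₁ * t) ∧
    (∀ x, 0 ≤ x → x ≤ S.y₂ t → S.Φ₃ x t = f₃ (x / (2 * √(M.α₃ * t)))) ∧
    (∀ x, S.y₂ t ≤ x → x ≤ S.y₁ t → S.Φ₂ x t = f₂ (x / (2 * √(M.α₂ * t)))) ∧
    (∀ x, S.y₁ t ≤ x → S.Φ₁ x t = f₁ (x / (2 * √(M.α₁ * t))))

/-- Similarity solutions of the problem (P1), with the convective condition. -/
def SolvesP1 (h₀ Ainf : ℝ) (S : Candidate) : Prop :=
  M.IsStefan S ∧ M.RobinCondition h₀ Ainf S ∧ M.IsSimilarity S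

/-- Similarity solutions of the problem (P2), with the temperature condition. -/
def SolvesP2 (A : ℝ) (S : Candidate) : Prop :=
  M.IsStefan S ∧ DirichletCondition A S ∧ M.IsSimilarity S

/-- `S` is the solution of (P1). -/
def IsTheSolutionP1 (h₀ Ainf : ℝ) (S : Candidate) : Prop :=
  M.SolvesP1 h₀ Ainf S ∧ ∀ T, M.SolvesP1 h₀ Ainf T → T.Coincide S

/-- `S` is the solution of (P2). -/
def IsTheSolutionP2 (A : ℝ) (S : Candidate) : Prop :=
  M.SolvesP2 A S ∧ ∀ T, M.SolvesP2 A T → T.Coincide S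

/-! ### The functions that determine the free boundary coefficients -/

def φ (z : ℝ) : ℝ := z + M.Ste₁ / √π * (Real.exp (-z ^ 2) / erfc z)

def H (z : ℝ) : ℝ :=
  erf (z * √(M.α₁ / M.α₂)) -
    M.Ste₂ / √π * (M.ℓ₂ / M.ℓ₁) * √(M.k₂ * M.c₁ / (M.k₁ * M.c₂)) *
      (Real.exp (-z ^ 2 * (M.α₁ / M.α₂)) / M.φ z)

def Q (z : ℝ) : ℝ := M.ℓ₁ / M.ℓ₂ * M.φ z * Real.exp (z ^ 2 * (M.α₁ / M.α₂))

/-- The coefficient of the second free boundary in terms of that of the first one. -/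
def second (z : ℝ) : ℝ := √(M.α₂ / M.α₁) * erfInv (M.H z)

def T (h₀ Ainf z : ℝ) : ℝ :=
  M.Ste₂ / (√π * M.c₂) * ((Ainf - M.B) / (M.B - M.C)) * √(M.k₃ * M.c₁ * M.c₃ / M.k₁) *
      (Real.exp (-z ^ 2 * M.α₁ * (1 / M.α₃ - 1 / M.α₂)) /
        (M.k₃ / (h₀ * √(π * M.α₃)) + erf (z * √(M.α₁ / M.α₃)))) -
    z * Real.exp (z ^ 2 * (M.α₁ / M.α₂))

def U (h₀ Ainf z : ℝ) : ℝ := M.T h₀ Ainf (M.second z)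

def V (A z : ℝ) : ℝ :=
  (A - M.B) / M.ℓ₂ * √(M.c₁ * M.c₃ * M.k₃ / (π * M.k₁)) *
      (Real.exp (-z ^ 2 * (M.α₁ / M.α₃ - M.α₁ / M.α₂)) / erf (z * √(M.α₁ / M.α₃))) -
    z * Real.exp (z ^ 2 * (M.α₁ / M.α₂))

/-- The threshold for the heat transfer coefficient; `z₀` is the positive zero of `H`. -/
def h₂ (z₀ Ainf : ℝ) : ℝ :=
  (M.B - M.C) / (Ainf - M.B) * √(M.k₂ * M.k₃ * M.c₂ / (π * M.c₃ * M.α₃)) *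
    (1 / erf (z₀ * √(M.α₁ / M.α₂)))

/-! ### Explicit solutions -/

/-- The explicit similarity solution for the convective condition. -/
def robinSolution (h₀ Ainf ξ₁ ξ₂ : ℝ) : Candidate where
  Φ₃ x t :=
    (M.B * M.k₃ / (h₀ * √(π * M.α₃)) + Ainf * erf (ξ₂ * √(M.α₁ / M.α₃)) -
        (Ainf - M.B) * erf (x / (2 * √(M.α₃ * t)))) /
      (M.k₃ / (h₀ * √(π * M.α₃)) + erf (ξ₂ * √(M.α₁ / M.α₃)))
  Φ₂ x t :=
    (-M.C * erf (ξ₂ * √(M.α₁ / M.α₂)) + M.B * erf (ξ₁ * √(M.α₁ / M.α₂)) -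
        (M.B - M.C) * erf (x / (2 * √(M.α₂ * t)))) /
      (erf (ξ₁ * √(M.α₁ / M.α₂)) - erf (ξ₂ * √(M.α₁ / M.α₂)))
  Φ₁ x t :=
    (M.C * (1 - erf (x / (2 * √(M.α₁ * t)))) +
        M.D * (erf (x / (2 * √(M.α₁ * t))) - erf ξ₁)) / erfc ξ₁
  y₁ t := 2 * ξ₁ * √(M.α₁ * t)
  y₂ t := 2 * ξ₂ * √(M.α₁ * t)

/-- The explicit similarity solution for the temperature condition. -/
def dirichletSolution (A μ₁ μ₂ : ℝ) : Candidate where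
  Φ₃ x t :=
    A * ((erf (μ₂ * √(M.α₁ / M.α₃)) - erf (x / (2 * √(M.α₃ * t)))) /
        erf (μ₂ * √(M.α₁ / M.α₃))) +
      M.B * (erf (x / (2 * √(M.α₃ * t))) / erf (μ₂ * √(M.α₁ / M.α₃)))
  Φ₂ x t :=
    ((M.C - M.B) * erf (x / (2 * √(M.α₂ * t))) - M.C * erf (μ₂ * √(M.α₁ / M.α₂)) +
        M.B * erf (μ₁ * √(M.α₁ / M.α₂))) /
      (erf (μ₁ * √(M.α₁ / M.α₂)) - erf (μ₂ * √(M.α₁ / M.α₂)))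
  Φ₁ x t := M.D + (M.C - M.D) * (erfc (x / (2 * √(M.α₁ * t))) / erfc μ₁)
  y₁ t := 2 * μ₁ * √(M.α₁ * t)
  y₂ t := 2 * μ₂ * √(M.α₁ * t)

/-- The temperature at the fixed face of the explicit solution for the convective condition. -/
def wallTemperature (h₀ Ainf ξ₂ : ℝ) : ℝ :=
  (M.B * M.k₃ / (h₀ * √(π * M.α₃)) + Ainf * erf (ξ₂ * √(M.α₁ / M.α₃))) /
    (M.k₃ / (h₀ * √(π * M.α₃)) + erf (ξ₂ * √(M.α₁ / M.α₃)))

end Data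

end ThreePhase

end

noncomputable section

namespace ThreePhase

open Set Filter

/-! ### Properties of the error function -/

/-! In the variable `η = x / (2√(at))` the heat equation becomes `g'' = -2η g'`, so every similarity
temperature is affine in `erf η` (`exists_erf_profile`). The temperatures prescribed at the two
fronts and at infinity then leave three unknowns: the front coefficients `ξ₁`, `ξ₂` and the slope
`P` of the third phase. This family is `profile`.

All fluxes and front speeds scale like `1/√t`, so each Stefan condition is one equation between
numbers. The one at `y₁` says `erf (ξ₂ √(α₁/α₂)) = H ξ₁` (`stefan₁_iff`), that is, `ξ₂ = second ξ₁`,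
and `ξ₂ > 0` forces `ξ₁ > z₀`. The one at `y₂` expresses `Q ξ₁` through `ξ₂` and `P`
(`stefan₂_iff`).

Both face conditions have the form `P (K + erf (ξ₂ √(α₁/α₃))) = d`: Dirichlet with `K = 0`, `d = A -
B`, Robin with `K = k₃/(h₀ √(πα₃))`, `d = A∞ - B`. Eliminating `P` gives `Q = W K (coeffW * d) ∘
second`, whose left side strictly increases while the right side decreases; a root exists once `Q z₀
* K < coeffW * d`. For Robin data this inequality is `h₂ < h₀`.

The two problems are equivalent because the equation at `y₂` sees the face condition only through
`P`. The prescribed `A`, respectively `h₀`, is the value for which the same `P` satisfies the other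
face condition; the same profile then solves both problems, and uniqueness holds in each. -/

lemma hasDerivAt_erf (x : ℝ) : HasDerivAt erf (2 / √π * Real.exp (-x ^ 2)) x := by
  have hc : Continuous fun u : ℝ => Real.exp (-u ^ 2) := by fun_prop
  exact (hc.integral_hasStrictDerivAt 0 x).hasDerivAt.const_mul _

lemma continuous_erf : Continuous erf :=
  continuous_iff_continuousAt.2 fun x => (hasDerivAt_erf x).continuousAt

lemma erf_zero : erf 0 = 0 := by simp [erf]

lemma two_div_sqrt_pi_pos : (0 : ℝ) < 2 / √π := by positivity

lemma strictMono_erf : StrictMono erf :=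
  strictMono_of_hasDerivAt_pos hasDerivAt_erf fun _ =>
    mul_pos two_div_sqrt_pi_pos (Real.exp_pos _)

lemma erf_pos {x : ℝ} (hx : 0 < x) : 0 < erf x := erf_zero ▸ strictMono_erf hx

lemma erf_neg (x : ℝ) : erf (-x) = -erf x := by
  have h := intervalIntegral.integral_comp_neg (a := 0) (b := x) (fun u : ℝ => Real.exp (-u ^ 2))
  simp only [neg_sq, neg_zero] at h
  rw [erf, erf, intervalIntegral.integral_symm, ← h]
  ring

lemma tendsto_erf_atTop : Tendsto erf atTop (𝓝 1) := by
  have hi : MeasureTheory.IntegrableOn (fun u : ℝ => Real.exp (-u ^ 2)) (Ioi 0) := by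
    simpa using (integrable_exp_neg_mul_sq (b := 1) one_pos).integrableOn
  have h := MeasureTheory.intervalIntegral_tendsto_integral_Ioi 0 hi tendsto_id
  have hg : ∫ u in Ioi (0 : ℝ), Real.exp (-u ^ 2) = √π / 2 := by
    simpa using integral_gaussian_Ioi 1
  rw [hg] at h
  have h2 := h.const_mul (2 / √π)
  have he : 2 / √π * (√π / 2) = 1 := by
    have : √π ≠ 0 := by positivity
    field_simp
  rw [he] at h2
  exact h2

lemma erf_lt_one (x : ℝ) : erf x < 1 :=
  (strictMono_erf (lt_add_one x)).trans_le <|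
    strictMono_erf.monotone.ge_of_tendsto tendsto_erf_atTop _

lemma erfc_pos (x : ℝ) : 0 < erfc x := sub_pos.2 (erf_lt_one x)

lemma hasDerivAt_erfc (x : ℝ) : HasDerivAt erfc (-(2 / √π * Real.exp (-x ^ 2))) x :=
  (hasDerivAt_erf x).const_sub 1

lemma tendsto_erfc_atTop : Tendsto erfc atTop (𝓝 0) := by
  have h := tendsto_erf_atTop.const_sub 1
  rw [sub_self] at h
  exact h

lemma continuous_erfc : Continuous erfc := continuous_const.sub continuous_erf

lemma erfInv_erf (x : ℝ) : erfInv (erf x) = x :=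
  Function.leftInverse_invFun strictMono_erf.injective x

lemma exists_erf_eq {y : ℝ} (h₁ : -1 < y) (h₂ : y < 1) : ∃ x, erf x = y := by
  obtain ⟨b, hb⟩ := (tendsto_erf_atTop.eventually (lt_mem_nhds h₂)).exists
  obtain ⟨a, ha⟩ := (tendsto_erf_atTop.eventually (lt_mem_nhds (neg_lt.1 h₁))).exists
  exact mem_range_of_exists_le_of_exists_ge continuous_erf
    ⟨-a, by rw [erf_neg]; linarith⟩ ⟨b, hb.le⟩

lemma erf_erfInv {y : ℝ} (h₁ : -1 < y) (h₂ : y < 1) : erf (erfInv y) = y :=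
  Function.invFun_eq (exists_erf_eq h₁ h₂)

lemma strictMonoOn_erfInv : StrictMonoOn erfInv (Ioo (-1) 1) := fun a ha b hb hab => by
  rw [← strictMono_erf.lt_iff_lt, erf_erfInv ha.1 ha.2, erf_erfInv hb.1 hb.2]
  exact hab

lemma neg_one_lt_erf (x : ℝ) : -1 < erf x := by
  have := erf_lt_one (-x)
  rw [erf_neg] at this
  linarith

/-- A monotone function whose image fills a neighbourhood cannot jump; here the image of `(-1, 1)`
is the whole line. -/
lemma continuousAt_erfInv {y : ℝ} (h₁ : -1 < y) (h₂ : y < 1) : ContinuousAt erfInv y := by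
  refine strictMonoOn_erfInv.continuousAt_of_image_mem_nhds (Ioo_mem_nhds h₁ h₂) ?_
  have : erfInv '' Ioo (-1) 1 = univ := eq_univ_of_forall fun x =>
    ⟨erf x, ⟨neg_one_lt_erf x, erf_lt_one x⟩, erfInv_erf x⟩
  rw [this]
  exact univ_mem

/-- The Mills ratio bound `√π z erfc z < exp (-z²)`. -/
lemma mul_erfc_lt {z : ℝ} (hz : 0 < z) : √π * z * erfc z < Real.exp (-z ^ 2) := by
  have hπ : 0 < √π := by positivity
  -- The gap between the two sides, divided by `√π x`, has negative derivative and tends to `0` at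
  -- infinity, hence is positive.
  have hd : ∀ x ∈ Ioi (0 : ℝ), HasDerivAt (fun x => Real.exp (-x ^ 2) / (√π * x) - erfc x)
      (-(Real.exp (-x ^ 2) / (√π * x ^ 2))) x := by
    intro x hx
    have hx' : x ≠ 0 := (mem_Ioi.1 hx).ne'
    have h1 : HasDerivAt (fun x : ℝ => Real.exp (-x ^ 2)) (Real.exp (-x ^ 2) * (-(2 * x))) x := by
      simpa using ((hasDerivAt_pow 2 x).neg).exp
    have h2 : HasDerivAt (fun x : ℝ => √π * x) (√π) x := by
      simpa using (hasDerivAt_id x).const_mul (√π)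
    refine ((h1.div h2 (by positivity)).sub (hasDerivAt_erfc x)).congr_deriv ?_
    field_simp
    ring
  have hanti : StrictAntiOn (fun x => Real.exp (-x ^ 2) / (√π * x) - erfc x) (Ioi 0) := by
    refine strictAntiOn_of_deriv_neg (convex_Ioi 0)
      (fun x hx => (hd x hx).continuousAt.continuousWithinAt) fun x hx => ?_
    rw [interior_Ioi] at hx
    rw [(hd x hx).deriv]
    have := mem_Ioi.1 hx
    exact neg_neg_of_pos (by positivity)
  have hlim : Tendsto (fun x => Real.exp (-x ^ 2) / (√π * x) - erfc x) atTop (𝓝 0) := by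
    have h1 : Tendsto (fun x : ℝ => Real.exp (-x ^ 2)) atTop (𝓝 0) :=
      Real.tendsto_exp_atBot.comp (tendsto_neg_atTop_atBot.comp (tendsto_pow_atTop two_ne_zero))
    have h2 := h1.div_atTop (tendsto_id.const_mul_atTop hπ)
    simpa using h2.sub tendsto_erfc_atTop
  -- The limit gives only a weak inequality; proving it at `z + 1` and descending to `z` makes it
  -- strict.
  have h0 : 0 ≤ Real.exp (-(z + 1) ^ 2) / (√π * (z + 1)) - erfc (z + 1) := by
    refine le_of_tendsto hlim ?_
    filter_upwards [eventually_ge_atTop (z + 1)] with x hx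
    exact hanti.antitoneOn (mem_Ioi.2 (by linarith)) (mem_Ioi.2 (by linarith)) hx
  have h1 := hanti (mem_Ioi.2 hz) (mem_Ioi.2 (by linarith)) (lt_add_one z)
  have h2 : erfc z < Real.exp (-z ^ 2) / (√π * z) := by
    simp only at h1
    linarith
  rw [lt_div_iff₀ (by positivity)] at h2
  linarith

/-- The derivative is a positive multiple of `exp (-x²) - √π x erfc x`, so the Mills ratio bound
gives its sign. -/
lemma strictMonoOn_exp_div_erfc : StrictMonoOn (fun z => Real.exp (-z ^ 2) / erfc z) (Ici 0) := by
  have hd : ∀ x : ℝ, HasDerivAt (fun z => Real.exp (-z ^ 2) / erfc z)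
      ((Real.exp (-x ^ 2) * (-(2 * x)) * erfc x -
        Real.exp (-x ^ 2) * (-(2 / √π * Real.exp (-x ^ 2)))) / erfc x ^ 2) x := by
    intro x
    have h1 : HasDerivAt (fun x : ℝ => Real.exp (-x ^ 2)) (Real.exp (-x ^ 2) * (-(2 * x))) x := by
      simpa using ((hasDerivAt_pow 2 x).neg).exp
    exact h1.div (hasDerivAt_erfc x) (erfc_pos x).ne'
  refine strictMonoOn_of_deriv_pos (convex_Ici 0)
    (fun x _ => (hd x).continuousAt.continuousWithinAt) fun x hx => ?_
  rw [interior_Ici] at hx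
  rw [(hd x).deriv]
  have h := mul_erfc_lt (mem_Ioi.1 hx)
  have hπ : 0 < √π := by positivity
  refine div_pos ?_ (pow_pos (erfc_pos x) 2)
  have : Real.exp (-x ^ 2) * (-(2 * x)) * erfc x -
      Real.exp (-x ^ 2) * (-(2 / √π * Real.exp (-x ^ 2))) =
      2 * Real.exp (-x ^ 2) / √π * (Real.exp (-x ^ 2) - √π * x * erfc x) := by
    field_simp
    ring
  rw [this]
  exact mul_pos (by positivity) (sub_pos.2 h)

namespace Data

variable (M : Data)

/-! ### The functions that determine the free boundary coefficients -/

lemma α₁_pos : 0 < M.α₁ := div_pos M.k₁_pos (mul_pos M.ρ_pos M.c₁_pos)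
lemma α₂_pos : 0 < M.α₂ := div_pos M.k₂_pos (mul_pos M.ρ_pos M.c₂_pos)
lemma α₃_pos : 0 < M.α₃ := div_pos M.k₃_pos (mul_pos M.ρ_pos M.c₃_pos)

lemma ratio₂_pos : 0 < √(M.α₁ / M.α₂) := Real.sqrt_pos.2 (div_pos M.α₁_pos M.α₂_pos)
lemma ratio₃_pos : 0 < √(M.α₁ / M.α₃) := Real.sqrt_pos.2 (div_pos M.α₁_pos M.α₃_pos)

lemma exponent_pos : 0 < M.α₁ / M.α₃ - M.α₁ / M.α₂ :=
  sub_pos.2 (div_lt_div_of_pos_left M.α₁_pos M.α₃_pos M.diffusivity_lt)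

lemma Ste₁_pos : 0 < M.Ste₁ := div_pos (mul_pos M.c₁_pos (sub_pos.2 M.D_lt_C)) M.ℓ₁_pos
lemma Ste₂_pos : 0 < M.Ste₂ := div_pos (mul_pos M.c₂_pos (sub_pos.2 M.C_lt_B)) M.ℓ₂_pos

lemma sqrt_pi_pos : 0 < √π := Real.sqrt_pos.2 Real.pi_pos

lemma lt_φ (z : ℝ) : z < M.φ z :=
  lt_add_of_pos_right z <| mul_pos (div_pos M.Ste₁_pos sqrt_pi_pos)
    (div_pos (Real.exp_pos _) (erfc_pos z))

lemma φ_pos {z : ℝ} (hz : 0 ≤ z) : 0 < M.φ z := hz.trans_lt (M.lt_φ z)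

lemma strictMonoOn_φ : StrictMonoOn M.φ (Ici 0) := fun _ ha _ hb hab =>
  add_lt_add hab <| mul_lt_mul_of_pos_left (strictMonoOn_exp_div_erfc ha hb hab)
    (div_pos M.Ste₁_pos sqrt_pi_pos)

lemma continuous_φ : Continuous M.φ := by
  have h : Continuous fun z => Real.exp (-z ^ 2) / erfc z :=
    Continuous.div (by fun_prop) continuous_erfc fun z => (erfc_pos z).ne'
  exact continuous_id.add (continuous_const.mul h)

lemma Q_pos {z : ℝ} (hz : 0 ≤ z) : 0 < M.Q z :=
  mul_pos (mul_pos (div_pos M.ℓ₁_pos M.ℓ₂_pos) (M.φ_pos hz)) (Real.exp_pos _)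

lemma strictMonoOn_Q : StrictMonoOn M.Q (Ici 0) := fun a ha b hb hab => by
  have hr := div_pos M.α₁_pos M.α₂_pos
  have hℓ := div_pos M.ℓ₁_pos M.ℓ₂_pos
  have hφ := M.strictMonoOn_φ ha hb hab
  have h2 : a ^ 2 ≤ b ^ 2 := pow_le_pow_left₀ ha hab.le 2
  have he : Real.exp (a ^ 2 * (M.α₁ / M.α₂)) ≤ Real.exp (b ^ 2 * (M.α₁ / M.α₂)) :=
    Real.exp_le_exp.2 (mul_le_mul_of_nonneg_right h2 hr.le)
  exact mul_lt_mul (mul_lt_mul_of_pos_left hφ hℓ) he (Real.exp_pos _)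
    (mul_pos hℓ (M.φ_pos hb)).le

lemma continuous_Q : Continuous M.Q :=
  (continuous_const.mul M.continuous_φ).mul (by fun_prop)

lemma le_Q {z : ℝ} (hz : 0 ≤ z) : M.ℓ₁ / M.ℓ₂ * z ≤ M.Q z := by
  have hr := div_pos M.α₁_pos M.α₂_pos
  have hℓ := div_pos M.ℓ₁_pos M.ℓ₂_pos
  have h1 : M.ℓ₁ / M.ℓ₂ * z ≤ M.ℓ₁ / M.ℓ₂ * M.φ z :=
    mul_le_mul_of_nonneg_left (M.lt_φ z).le hℓ.le
  exact h1.trans (le_mul_of_one_le_right (mul_pos hℓ (M.φ_pos hz)).le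
    (Real.one_le_exp (by positivity)))

/-- The coefficient in the definition of `H`. -/
def coeffH : ℝ := M.Ste₂ / √π * (M.ℓ₂ / M.ℓ₁) * √(M.k₂ * M.c₁ / (M.k₁ * M.c₂))

lemma coeffH_pos : 0 < M.coeffH :=
  mul_pos (mul_pos (div_pos M.Ste₂_pos sqrt_pi_pos) (div_pos M.ℓ₂_pos M.ℓ₁_pos))
    (Real.sqrt_pos.2 (div_pos (mul_pos M.k₂_pos M.c₁_pos) (mul_pos M.k₁_pos M.c₂_pos)))

lemma H_eq (z : ℝ) : M.H z = erf (z * √(M.α₁ / M.α₂)) -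
    M.coeffH * (Real.exp (-z ^ 2 * (M.α₁ / M.α₂)) / M.φ z) := rfl

lemma H_lt {z : ℝ} (hz : 0 ≤ z) : M.H z < erf (z * √(M.α₁ / M.α₂)) := by
  rw [H_eq]
  exact sub_lt_self _ (mul_pos M.coeffH_pos (div_pos (Real.exp_pos _) (M.φ_pos hz)))

lemma strictMonoOn_H : StrictMonoOn M.H (Ici 0) := fun a ha b hb hab => by
  have hr := div_pos M.α₁_pos M.α₂_pos
  have h2 : a ^ 2 ≤ b ^ 2 := pow_le_pow_left₀ ha hab.le 2
  have he : Real.exp (-b ^ 2 * (M.α₁ / M.α₂)) ≤ Real.exp (-a ^ 2 * (M.α₁ / M.α₂)) :=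
    Real.exp_le_exp.2 (mul_le_mul_of_nonneg_right (neg_le_neg h2) hr.le)
  have hd := div_le_div₀ (Real.exp_pos _).le he (M.φ_pos ha) (M.strictMonoOn_φ ha hb hab).le
  have hm := mul_le_mul_of_nonneg_left hd M.coeffH_pos.le
  have hE := strictMono_erf (mul_lt_mul_of_pos_right hab M.ratio₂_pos)
  rw [H_eq, H_eq]
  linarith

lemma continuousOn_H : ContinuousOn M.H (Ici 0) := by
  have h : ContinuousOn (fun z => Real.exp (-z ^ 2 * (M.α₁ / M.α₂)) / M.φ z) (Ici 0) :=
    ContinuousOn.div (by fun_prop) M.continuous_φ.continuousOn fun z hz => (M.φ_pos hz).ne'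
  exact (continuous_erf.comp (continuous_id.mul continuous_const)).continuousOn.sub
    (continuousOn_const.mul h)

lemma H_zero_neg : M.H 0 < 0 := by
  simpa [erf_zero] using M.H_lt le_rfl

/-- Since `φ z > z` and the exponential is at most `1`, `H z` is at least `erf (z √(α₁/α₂)) - coeffH
/ z` for `z > 0`, which tends to `1`. -/
lemma exists_H_pos : ∃ z, 0 < z ∧ 0 < M.H z := by
  have h1 : Tendsto (fun z : ℝ => erf (z * √(M.α₁ / M.α₂)) - M.coeffH / z) atTop (𝓝 (1 - 0)) :=
    (tendsto_erf_atTop.comp (tendsto_id.atTop_mul_const M.ratio₂_pos)).sub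
      (tendsto_const_nhds.div_atTop tendsto_id)
  rw [sub_zero] at h1
  obtain ⟨z, hz, hz0⟩ := ((h1.eventually (lt_mem_nhds one_pos)).and (eventually_gt_atTop 0)).exists
  refine ⟨z, hz0, hz.trans_le ?_⟩
  have hr := div_pos M.α₁_pos M.α₂_pos
  have he : Real.exp (-z ^ 2 * (M.α₁ / M.α₂)) ≤ 1 := Real.exp_le_one_iff.2 <| by
    rw [neg_mul]
    exact neg_nonpos.2 (by positivity)
  have hd := div_le_div₀ zero_le_one he hz0 (M.lt_φ z).le
  have hm := mul_le_mul_of_nonneg_left hd M.coeffH_pos.le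
  rw [mul_one_div] at hm
  rw [H_eq]
  linarith

lemma existsUnique_zero_H : ∃! z : ℝ, 0 < z ∧ M.H z = 0 := by
  obtain ⟨b, hb, hHb⟩ := M.exists_H_pos
  obtain ⟨z, hz, hHz⟩ := intermediate_value_Icc hb.le (M.continuousOn_H.mono Icc_subset_Ici_self)
    ⟨M.H_zero_neg.le, hHb.le⟩
  have hz0 : z ≠ 0 := by
    rintro rfl
    exact M.H_zero_neg.ne hHz
  refine ⟨z, ⟨hz.1.lt_of_ne' hz0, hHz⟩, fun w hw => ?_⟩
  exact M.strictMonoOn_H.injOn (mem_Ici.2 hw.1.le) (mem_Ici.2 hz.1) (hw.2.trans hHz.symm)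

lemma sqrt_ratio_mul : √(M.α₂ / M.α₁) * √(M.α₁ / M.α₂) = 1 := by
  have h1 := M.α₁_pos
  have h2 := M.α₂_pos
  rw [← Real.sqrt_mul (by positivity), div_mul_div_cancel₀ h1.ne', div_self h2.ne', Real.sqrt_one]

/-- Used in uniqueness: the Stefan condition at `y₁` determines `ξ₂` from `ξ₁`. -/
lemma second_eq_of_erf_eq {z s : ℝ} (h : erf (s * √(M.α₁ / M.α₂)) = M.H z) : M.second z = s := by
  rw [second, ← h, erfInv_erf, mul_comm s, ← mul_assoc, sqrt_ratio_mul, one_mul]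

/-! ### The map `second` on `[z₀, ∞)`, where `H` lies in the range of `erf` -/

section

variable {M} {z₀ : ℝ}

lemma H_mem (h₀ : 0 < z₀) (hH : M.H z₀ = 0)
    {z : ℝ} (hz : z₀ ≤ z) : M.H z ∈ Ico (0 : ℝ) 1 :=
  ⟨hH ▸ M.strictMonoOn_H.monotoneOn (mem_Ici.2 h₀.le) (mem_Ici.2 (h₀.le.trans hz)) hz,
    (M.H_lt (h₀.le.trans hz)).trans (erf_lt_one _)⟩

lemma erf_second (h₀ : 0 < z₀) (hH : M.H z₀ = 0)
    {z : ℝ} (hz : z₀ ≤ z) : erf (M.second z * √(M.α₁ / M.α₂)) = M.H z := by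
  have h := H_mem h₀ hH hz
  rw [second, mul_right_comm, sqrt_ratio_mul, one_mul, erf_erfInv (by linarith [h.1]) h.2]

lemma second_lt (h₀ : 0 < z₀) (hH : M.H z₀ = 0)
    {z : ℝ} (hz : z₀ ≤ z) : M.second z < z := by
  have h := M.H_lt (h₀.le.trans hz)
  rw [← erf_second h₀ hH hz, strictMono_erf.lt_iff_lt] at h
  exact lt_of_mul_lt_mul_right h M.ratio₂_pos.le

lemma strictMonoOn_second (h₀ : 0 < z₀) (hH : M.H z₀ = 0)
    : StrictMonoOn M.second (Ici z₀) := fun a ha b hb hab => by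
  have h := M.strictMonoOn_H (h₀.le.trans ha) (h₀.le.trans hb) hab
  rw [← erf_second h₀ hH ha, ← erf_second h₀ hH hb, strictMono_erf.lt_iff_lt] at h
  exact lt_of_mul_lt_mul_right h M.ratio₂_pos.le

lemma second_zero (hH : M.H z₀ = 0) : M.second z₀ = 0 :=
  M.second_eq_of_erf_eq (by rw [zero_mul, erf_zero, hH])

lemma second_pos (h₀ : 0 < z₀) (hH : M.H z₀ = 0)
    {z : ℝ} (hz : z₀ < z) : 0 < M.second z :=
  second_zero hH ▸ strictMonoOn_second h₀ hH self_mem_Ici hz.le hz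

lemma continuousOn_second (h₀ : 0 < z₀) (hH : M.H z₀ = 0)
    : ContinuousOn M.second (Ici z₀) := by
  refine continuousOn_const.mul fun z hz => ?_
  have h := H_mem h₀ hH hz
  exact (continuousAt_erfInv (by linarith [h.1]) h.2).comp_continuousWithinAt
    ((M.continuousOn_H.mono (Ici_subset_Ici.2 h₀.le)) z hz)

end

/-- The common form of the functions `T` and `V`. -/
def W (K c s : ℝ) : ℝ :=
  c * (Real.exp (-s ^ 2 * (M.α₁ / M.α₃ - M.α₁ / M.α₂)) / (K + erf (s * √(M.α₁ / M.α₃)))) -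
    s * Real.exp (s ^ 2 * (M.α₁ / M.α₂))

variable {M}

lemma add_erf_pos {K s : ℝ} (hK : 0 ≤ K) (hs : 0 < s) : 0 < K + erf (s * √(M.α₁ / M.α₃)) :=
  add_pos_of_nonneg_of_pos hK (erf_pos (mul_pos hs M.ratio₃_pos))

/-- The assumption `α₃ < α₂` makes the first exponential decay; on `s > 0` the denominator is
positive even for `K = 0`. -/
lemma antitoneOn_W {K c : ℝ} (hK : 0 ≤ K) (hc : 0 < c) : AntitoneOn (M.W K c) (Ioi 0) :=
  fun a ha b hb hab => by
  have hr := div_pos M.α₁_pos M.α₂_pos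
  have h2 : a ^ 2 ≤ b ^ 2 := pow_le_pow_left₀ (le_of_lt ha) hab 2
  have he1 : Real.exp (-b ^ 2 * (M.α₁ / M.α₃ - M.α₁ / M.α₂)) ≤
      Real.exp (-a ^ 2 * (M.α₁ / M.α₃ - M.α₁ / M.α₂)) :=
    Real.exp_le_exp.2 (mul_le_mul_of_nonneg_right (neg_le_neg h2) M.exponent_pos.le)
  have he2 : Real.exp (a ^ 2 * (M.α₁ / M.α₂)) ≤ Real.exp (b ^ 2 * (M.α₁ / M.α₂)) :=
    Real.exp_le_exp.2 (mul_le_mul_of_nonneg_right h2 hr.le)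
  have hE : K + erf (a * √(M.α₁ / M.α₃)) ≤ K + erf (b * √(M.α₁ / M.α₃)) :=
    add_le_add le_rfl
      (strictMono_erf.monotone (mul_le_mul_of_nonneg_right hab M.ratio₃_pos.le))
  have hd := div_le_div₀ (Real.exp_pos _).le he1 (add_erf_pos hK ha) hE
  have h3 := mul_le_mul hab he2 (Real.exp_pos _).le (le_of_lt hb)
  have h4 := mul_le_mul_of_nonneg_left hd hc.le
  simp only [W]
  linarith

lemma root_unique {z₀ K c : ℝ} (h₀ : 0 < z₀) (hH : M.H z₀ = 0) (hK : 0 ≤ K) (hc : 0 < c)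
    {a b : ℝ} (ha : z₀ < a) (hb : z₀ < b) (hQa : M.Q a = M.W K c (M.second a))
    (hQb : M.Q b = M.W K c (M.second b)) : a = b := by
  have key : ∀ {a b : ℝ}, z₀ < a → M.Q a = M.W K c (M.second a) →
      M.Q b = M.W K c (M.second b) → ¬ a < b := by
    intro a b ha hQa hQb hab
    have h1 := M.strictMonoOn_Q (mem_Ici.2 (h₀.trans ha).le)
      (mem_Ici.2 ((h₀.trans ha).trans hab).le) hab
    have h2 := antitoneOn_W (M := M) hK hc (second_pos h₀ hH ha)
      (second_pos h₀ hH (ha.trans hab))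
      (strictMonoOn_second h₀ hH ha.le (ha.trans hab).le hab).le
    rw [hQa, hQb] at h1
    exact h1.not_ge h2
  exact le_antisymm (not_lt.1 (key hb hQb hQa)) (not_lt.1 (key ha hQa hQb))

/-- The equation `Q = W ∘ second` cleared of its denominator. -/
lemma root_iff {K c z : ℝ} (hd : 0 < K + erf (M.second z * √(M.α₁ / M.α₃))) :
    M.Q z = M.W K c (M.second z) ↔
      (M.Q z + M.second z * Real.exp (M.second z ^ 2 * (M.α₁ / M.α₂))) *
        (K + erf (M.second z * √(M.α₁ / M.α₃))) -
      c * Real.exp (-M.second z ^ 2 * (M.α₁ / M.α₃ - M.α₁ / M.α₂)) = 0 := by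
  rw [W, eq_sub_iff_add_eq, ← mul_div_assoc c, eq_div_iff hd.ne', sub_eq_zero]

/-- For `K = 0` the denominator vanishes at `z₀`, so the intermediate value theorem is applied to
the equation cleared of it. The hypothesis `hc` says exactly that the cleared function is negative
at `z₀`, where `second` vanishes. -/
lemma existsUnique_root {z₀ K c : ℝ} (h₀ : 0 < z₀) (hH : M.H z₀ = 0) (hK : 0 ≤ K)
    (hc : M.Q z₀ * K < c) : ∃! z, z₀ < z ∧ M.Q z = M.W K c (M.second z) := by
  have hc0 : 0 < c := (mul_nonneg (M.Q_pos h₀.le).le hK).trans_lt hc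
  set g : ℝ → ℝ := fun z => (M.Q z + M.second z * Real.exp (M.second z ^ 2 * (M.α₁ / M.α₂))) *
        (K + erf (M.second z * √(M.α₁ / M.α₃))) -
      c * Real.exp (-M.second z ^ 2 * (M.α₁ / M.α₃ - M.α₁ / M.α₂)) with hg
  have hs := continuousOn_second h₀ hH
  have hcont : ContinuousOn g (Ici z₀) := by
    have h1 : ContinuousOn (fun z => erf (M.second z * √(M.α₁ / M.α₃))) (Ici z₀) :=
      continuous_erf.comp_continuousOn (hs.mul continuousOn_const)
    have h2 := M.continuous_Q.continuousOn (s := Ici z₀)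
    exact ((h2.add (hs.mul ((hs.pow 2).mul continuousOn_const).rexp)).mul
      (continuousOn_const.add h1)).sub
      (continuousOn_const.mul ((hs.pow 2).neg.mul continuousOn_const).rexp)
  have hg0 : g z₀ < 0 := by
    simp only [hg, second_zero hH, zero_mul, erf_zero]
    norm_num
    exact hc
  -- A positive lower bound for the denominator to the right of `z₀ + 1`, valid also when `K = 0`.
  set e := erf (M.second (z₀ + 1) * √(M.α₁ / M.α₃)) with he
  have he0 : 0 < e := erf_pos (mul_pos (second_pos h₀ hH (lt_add_one z₀)) M.ratio₃_pos)
  obtain ⟨b, hb, hQb⟩ : ∃ b, z₀ + 1 ≤ b ∧ c ≤ M.Q b * e := by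
    have hℓ := div_pos M.ℓ₁_pos M.ℓ₂_pos
    -- `Q` grows at least like `(ℓ₁/ℓ₂) z`, so this point achieves `c ≤ Q b * e`.
    refine ⟨max (z₀ + 1) (c / e / (M.ℓ₁ / M.ℓ₂)), le_max_left _ _, ?_⟩
    rw [← div_le_iff₀ he0]
    refine le_trans ?_ (M.le_Q (le_max_of_le_left (by linarith)))
    rw [← div_le_iff₀' hℓ]
    exact le_max_right _ _
  have hzb : z₀ < b := by linarith
  have hsb := second_pos h₀ hH hzb
  have hgb : 0 ≤ g b := by
    have h1 : e ≤ K + erf (M.second b * √(M.α₁ / M.α₃)) := by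
      have h2 := (strictMonoOn_second h₀ hH).monotoneOn (mem_Ici.2 (lt_add_one z₀).le)
        (mem_Ici.2 hzb.le) hb
      have h3 := strictMono_erf.monotone (mul_le_mul_of_nonneg_right h2 M.ratio₃_pos.le)
      linarith
    have h4 : M.Q b ≤ M.Q b + M.second b * Real.exp (M.second b ^ 2 * (M.α₁ / M.α₂)) :=
      le_add_of_nonneg_right (by positivity)
    have hQ0 := M.Q_pos (h₀.trans hzb).le
    have h5 := mul_le_mul h4 h1 he0.le (hQ0.le.trans h4)
    have h6 : Real.exp (-M.second b ^ 2 * (M.α₁ / M.α₃ - M.α₁ / M.α₂)) ≤ 1 :=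
      Real.exp_le_one_iff.2 (mul_nonpos_of_nonpos_of_nonneg (neg_nonpos.2 (sq_nonneg _))
        M.exponent_pos.le)
    have h7 := mul_le_mul_of_nonneg_left h6 hc0.le
    simp only [hg]
    linarith
  obtain ⟨z, hz, hgz⟩ := intermediate_value_Icc hzb.le (hcont.mono Icc_subset_Ici_self)
    ⟨hg0.le, hgb⟩
  have hz0 : z₀ < z := hz.1.lt_of_ne (by rintro rfl; exact hg0.ne hgz)
  refine ⟨z, ⟨hz0, (root_iff (add_erf_pos hK (second_pos h₀ hH hz0))).2 hgz⟩, fun w hw => ?_⟩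
  exact root_unique h₀ hH hK hc0 hw.1 hz0 hw.2
    ((root_iff (add_erf_pos hK (second_pos h₀ hH hz0))).2 hgz)

end Data

/-! ### Similarity solutions of the heat equation -/

/-- The general similarity solution of the heat equation with diffusivity `a`. -/
def temp (a p q x t : ℝ) : ℝ := p + q * erf (x / (2 * √(a * t)))

section

variable {a t : ℝ}

lemma two_sqrt_pos (ha : 0 < a) (ht : 0 < t) : 0 < 2 * √(a * t) :=
  mul_pos two_pos (Real.sqrt_pos.2 (mul_pos ha ht))

lemma hasDerivAt_similarity_variable (ha : 0 < a) (ht : 0 < t) (x : ℝ) :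
    HasDerivAt (fun s => x / (2 * √(a * s))) (-(x / (2 * √(a * t))) / (2 * t)) t := by
  have hs : 0 < √(a * t) := Real.sqrt_pos.2 (mul_pos ha ht)
  have hsq : √(a * t) ^ 2 = a * t := Real.sq_sqrt (mul_pos ha ht).le
  have h1 : HasDerivAt (fun s => √(a * s)) (a / (2 * √(a * t))) t := by
    simpa using ((hasDerivAt_id t).const_mul a).sqrt (mul_pos ha ht).ne'
  refine ((hasDerivAt_const t x).div (h1.const_mul 2) (by positivity)).congr_deriv ?_
  field_simp
  rw [hsq]
  ring

lemma hasDerivAt_temp_space (a p q x t : ℝ) :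
    HasDerivAt (fun z => temp a p q z t)
      (q * (2 / √π * Real.exp (-(x / (2 * √(a * t))) ^ 2) * (1 / (2 * √(a * t))))) x :=
  (((hasDerivAt_erf _).comp x ((hasDerivAt_id x).div_const _)).const_mul q).const_add p

lemma heatAt_temp (ha : 0 < a) (ht : 0 < t) (p q x : ℝ) : HeatAt a (temp a p q) x t := by
  have hs := two_sqrt_pos ha ht
  have hsq : √(a * t) ^ 2 = a * t := Real.sq_sqrt (mul_pos ha ht).le
  have h1 : HasDerivAt (fun s => temp a p q x s) (q * (2 / √π *
      Real.exp (-(x / (2 * √(a * t))) ^ 2) * (-(x / (2 * √(a * t))) / (2 * t)))) t :=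
    (((hasDerivAt_erf _).comp t (hasDerivAt_similarity_variable ha ht x)).const_mul q).const_add p
  have h2 : (deriv fun z => temp a p q z t) = fun z =>
      q * (2 / √π * Real.exp (-(z / (2 * √(a * t))) ^ 2) * (1 / (2 * √(a * t)))) :=
    funext fun z => (hasDerivAt_temp_space a p q z t).deriv
  have h3 : HasDerivAt (fun z =>
      q * (2 / √π * Real.exp (-(z / (2 * √(a * t))) ^ 2) * (1 / (2 * √(a * t)))))
      (q * (2 / √π * (Real.exp (-(x / (2 * √(a * t))) ^ 2) *
        (-(2 * (x / (2 * √(a * t))) * (1 / (2 * √(a * t)))))) * (1 / (2 * √(a * t))))) x := by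
    have h4 : HasDerivAt (fun z : ℝ => z / (2 * √(a * t))) (1 / (2 * √(a * t))) x :=
      (hasDerivAt_id x).div_const _
    have h5 : HasDerivAt (fun z : ℝ => -(z / (2 * √(a * t))) ^ 2)
        (-(2 * (x / (2 * √(a * t))) * (1 / (2 * √(a * t))))) x :=
      (h4.pow 2).neg.congr_deriv (by simp)
    exact ((h5.exp.const_mul _).mul_const _).const_mul q
  refine ⟨h1.differentiableAt, (hasDerivAt_temp_space a p q x t).differentiableAt, ?_, ?_⟩
  · rw [h2]
    exact h3.differentiableAt
  · rw [h2, h1.deriv, h3.deriv]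
    have hs' : 0 < √(a * t) := Real.sqrt_pos.2 (mul_pos ha ht)
    have hp := Data.sqrt_pi_pos
    generalize Real.exp (-(x / (2 * √(a * t))) ^ 2) = E
    field_simp
    rw [hsq]
    ring

lemma continuousOn_temp (ha : 0 < a) (p q : ℝ) :
    ContinuousOn (fun z : ℝ × ℝ => temp a p q z.1 z.2) {z | 0 < z.2} := by
  refine continuousOn_const.add (continuousOn_const.mul
    (continuous_erf.comp_continuousOn (ContinuousOn.div (by fun_prop) (by fun_prop) ?_)))
  exact fun z hz => (two_sqrt_pos ha hz).ne'

lemma div_two_sqrt_eq {b : ℝ} (ha : 0 < a) (hb : 0 < b) (ht : 0 < t) (ξ : ℝ) :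
    2 * ξ * √(b * t) / (2 * √(a * t)) = ξ * √(b / a) := by
  have hs : 0 < √(a * t) := Real.sqrt_pos.2 (mul_pos ha ht)
  have h : √(b / a) * √(a * t) = √(b * t) := by
    rw [← Real.sqrt_mul (div_pos hb ha).le]
    congr 1
    field_simp
  rw [← h]
  field_simp

lemma div_two_sqrt_le_iff {b x : ℝ} (ha : 0 < a) (hb : 0 < b) (ht : 0 < t) (ξ : ℝ) :
    x / (2 * √(a * t)) ≤ ξ * √(b / a) ↔ x ≤ 2 * ξ * √(b * t) := by
  rw [← div_two_sqrt_eq ha hb ht, div_le_div_iff_of_pos_right (two_sqrt_pos ha ht)]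

lemma le_div_two_sqrt_iff {b x : ℝ} (ha : 0 < a) (hb : 0 < b) (ht : 0 < t) (ξ : ℝ) :
    ξ * √(b / a) ≤ x / (2 * √(a * t)) ↔ 2 * ξ * √(b * t) ≤ x := by
  rw [← div_two_sqrt_eq ha hb ht, div_le_div_iff_of_pos_right (two_sqrt_pos ha ht)]

lemma hasDerivAt_temp_front {b : ℝ} (ha : 0 < a) (hb : 0 < b) (ht : 0 < t) (p q ξ : ℝ) :
    HasDerivAt (fun x => temp a p q x t)
      (q * Real.exp (-ξ ^ 2 * (b / a)) / (√π * √a * √t)) (2 * ξ * √(b * t)) := by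
  refine (hasDerivAt_temp_space a p q _ t).congr_deriv ?_
  have h : -(ξ * √(b / a)) ^ 2 = -ξ ^ 2 * (b / a) := by
    rw [mul_pow, Real.sq_sqrt (div_pos hb ha).le, neg_mul]
  rw [div_two_sqrt_eq ha hb ht, h, Real.sqrt_mul ha.le]
  have h1 := Real.sqrt_pos.2 ha
  have h2 := Real.sqrt_pos.2 ht
  have hp := Data.sqrt_pi_pos
  field_simp

lemma hasDerivAt_front {b : ℝ} (hb : 0 < b) (ht : 0 < t) (ξ : ℝ) :
    HasDerivAt (fun s => 2 * ξ * √(b * s)) (ξ * √b / √t) t := by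
  have h1 : HasDerivAt (fun s => √(b * s)) (b / (2 * √(b * t))) t := by
    simpa using ((hasDerivAt_id t).const_mul b).sqrt (mul_pos hb ht).ne'
  refine (h1.const_mul (2 * ξ)).congr_deriv ?_
  rw [Real.sqrt_mul hb.le]
  have h2 := Real.sqrt_pos.2 hb
  have h3 := Real.sqrt_pos.2 ht
  have h4 : √b ^ 2 = b := Real.sq_sqrt hb.le
  field_simp
  rw [h4]

end

/-- A solution of the heat equation that depends on `x / (2 √(a t))` only is an affine function
of the error function of this variable. -/
lemma exists_erf_profile {a : ℝ} (ha : 0 < a) {J : Set ℝ} (hconn : IsPreconnected (interior J))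
    (hJ : J ⊆ closure (interior J)) {Φ : ℝ → ℝ → ℝ} {f : ℝ → ℝ}
    (hΦ : ∀ t, 0 < t → ∀ x, x / (2 * √(a * t)) ∈ J → Φ x t = f (x / (2 * √(a * t))))
    (hheat : ∀ t, 0 < t → ∀ x, x / (2 * √(a * t)) ∈ interior J → HeatAt a Φ x t)
    (hcont : ∀ t, 0 < t → ContinuousOn (fun x => Φ x t) {x | x / (2 * √(a * t)) ∈ J}) :
    ∃ p q, ∀ t, 0 < t → ∀ x, x / (2 * √(a * t)) ∈ J → Φ x t = temp a p q x t := by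
  -- At this time `2√(aτ) = 1`, so `x` itself is the similarity variable and `f` inherits on `J` the
  -- spatial regularity of `Φ · τ`.
  set τ : ℝ := 1 / (4 * a) with hτ
  have hτ0 : 0 < τ := by positivity
  have hone : 2 * √(a * τ) = 1 := by
    have h : a * τ = (1 / 2) ^ 2 := by
      rw [hτ]
      field_simp
      norm_num
    rw [h, Real.sqrt_sq (by norm_num)]
    norm_num
  set g : ℝ → ℝ := fun x => Φ x τ with hg
  have hfg : ∀ η ∈ J, f η = g η := fun η hη => by
    have h := hΦ τ hτ0 η (by rwa [hone, div_one])
    rw [hone, div_one] at h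
    exact h.symm
  have hheatτ : ∀ η ∈ interior J, HeatAt a Φ η τ := fun η hη =>
    hheat τ hτ0 η (by rwa [hone, div_one])
  -- Near `τ`, `Φ η s = g (η / (2√(as)))`; its time derivative at `τ` comes from the chain rule, and
  -- the heat equation turns into an ordinary differential equation.
  have hode : ∀ η ∈ interior J, deriv (deriv g) η = -(2 * η) * deriv g η := by
    intro η hη
    obtain ⟨-, h2, -, h4⟩ := hheatτ η hη
    have hd := hasDerivAt_similarity_variable ha hτ0 η
    have hgd : HasDerivAt g (deriv g η) (η / (2 * √(a * τ))) := by
      rw [hone, div_one]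
      exact h2.hasDerivAt
    have hcomp := hgd.comp τ hd
    have hev : (fun s => Φ η s) =ᶠ[𝓝 τ] g ∘ fun s => η / (2 * √(a * s)) := by
      have hmem : ∀ᶠ s in 𝓝 τ, η / (2 * √(a * s)) ∈ interior J :=
        hd.continuousAt.eventually_mem (by
          rw [hone, div_one]
          exact isOpen_interior.mem_nhds hη)
      filter_upwards [hmem, lt_mem_nhds hτ0] with s hs hs0
      rw [hΦ s hs0 η (interior_subset hs), hfg _ (interior_subset hs), Function.comp_apply]
    rw [(hcomp.congr_of_eventuallyEq hev).deriv, hone, div_one] at h4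
    have h5 : a * deriv (deriv g) η = a * (-(2 * η) * deriv g η) := by
      rw [← h4, hτ]
      field_simp
      ring
    exact mul_left_cancel₀ ha.ne' h5
  -- `exp (η²)` is the integrating factor; then `g' = c exp (-η²)` integrates to `(c √π / 2) erf`.
  obtain ⟨c, hc⟩ : ∃ c, ∀ η ∈ interior J, deriv g η * Real.exp (η ^ 2) = c := by
    have hd : ∀ η ∈ interior J, HasDerivAt (fun η => deriv g η * Real.exp (η ^ 2)) 0 η := by
      intro η hη
      have h1 : HasDerivAt (fun x : ℝ => Real.exp (x ^ 2)) (Real.exp (η ^ 2) * (2 * η)) η := by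
        simpa using (hasDerivAt_pow 2 η).exp
      refine ((hheatτ η hη).2.2.1.hasDerivAt.mul h1).congr_deriv ?_
      have := hode η hη
      simp only [hg] at this ⊢
      rw [this]
      ring
    exact isOpen_interior.exists_is_const_of_deriv_eq_zero hconn
      (fun η hη => (hd η hη).differentiableAt.differentiableWithinAt) fun η hη => (hd η hη).deriv
  obtain ⟨p, hp⟩ : ∃ p, ∀ η ∈ interior J, g η - c * √π / 2 * erf η = p := by
    have hd : ∀ η ∈ interior J, HasDerivAt (fun η => g η - c * √π / 2 * erf η) 0 η := by
      intro η hη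
      have h1 : HasDerivAt g (deriv g η) η := (hheatτ η hη).2.1.hasDerivAt
      refine (h1.sub ((hasDerivAt_erf η).const_mul (c * √π / 2))).congr_deriv ?_
      have hπ := Data.sqrt_pi_pos
      rw [← hc η hη, Real.exp_neg]
      have := Real.exp_pos (η ^ 2)
      field_simp
      ring
    exact isOpen_interior.exists_is_const_of_deriv_eq_zero hconn
      (fun η hη => (hd η hη).differentiableAt.differentiableWithinAt) fun η hη => (hd η hη).deriv
  refine ⟨p, c * √π / 2, fun t ht x hx => ?_⟩
  have hgc : ContinuousOn g J := by
    have := hcont τ hτ0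
    simpa only [hone, div_one, ofPred_mem_eq] using this
  -- The formula passes from the interior to the boundary points of `J` by continuity.
  have heq : EqOn g (fun η => p + c * √π / 2 * erf η) J := by
    refine EqOn.of_subset_closure (s := interior J) (fun η hη => ?_) hgc
      (continuous_const.add (continuous_const.mul continuous_erf)).continuousOn
      interior_subset hJ
    rw [← hp η hη]
    ring
  rw [hΦ t ht x hx, hfg _ hx, heq hx, temp]

namespace Data

variable (M : Data)

/-! ### Algebraic form of the Stefan conditions -/

lemma sqrt_α_facts : 0 < √M.α₁ ∧ 0 < √M.α₂ ∧ 0 < √M.α₃ :=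
  ⟨Real.sqrt_pos.2 M.α₁_pos, Real.sqrt_pos.2 M.α₂_pos, Real.sqrt_pos.2 M.α₃_pos⟩

/-- The coefficient of the heat flux in the definitions of `T` and `V`. -/
def coeffW : ℝ := 1 / M.ℓ₂ * √(M.c₁ * M.c₃ * M.k₃ / (π * M.k₁))

lemma coeffW_pos : 0 < M.coeffW :=
  mul_pos (one_div_pos.2 M.ℓ₂_pos) (Real.sqrt_pos.2 (div_pos
    (mul_pos (mul_pos M.c₁_pos M.c₃_pos) M.k₃_pos) (mul_pos Real.pi_pos M.k₁_pos)))

lemma coeffW_eq : M.coeffW = M.k₃ / (√π * √M.α₃ * (M.ρ * M.ℓ₂) * √M.α₁) := by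
  obtain ⟨h1, -, h3⟩ := M.sqrt_α_facts
  have hk1 := M.k₁_pos; have hk3 := M.k₃_pos; have hc1 := M.c₁_pos; have hc3 := M.c₃_pos
  have hρ := M.ρ_pos; have hℓ := M.ℓ₂_pos; have hπ := Real.pi_pos; have hp := sqrt_pi_pos
  have h : √(M.c₁ * M.c₃ * M.k₃ / (π * M.k₁)) = M.k₃ / (√π * √M.α₃ * M.ρ * √M.α₁) := by
    rw [Real.sqrt_eq_iff_eq_sq (by positivity) (by positivity), div_pow, mul_pow, mul_pow, mul_pow,
      Real.sq_sqrt hπ.le, Real.sq_sqrt M.α₁_pos.le, Real.sq_sqrt M.α₃_pos.le, α₁, α₃]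
    field_simp
  rw [coeffW, h]
  field_simp

/-- Expressed through the diffusivities, the coefficient becomes a ratio of heat flux to latent
heat, the form in which it appears in the Stefan condition. -/
lemma coeffH_eq :
    M.coeffH = M.k₂ * (M.B - M.C) / (√π * √M.α₂ * (M.ρ * M.ℓ₁) * √M.α₁) := by
  obtain ⟨h1, h2, -⟩ := M.sqrt_α_facts
  have hk1 := M.k₁_pos; have hk2 := M.k₂_pos; have hc1 := M.c₁_pos; have hc2 := M.c₂_pos
  have hρ := M.ρ_pos; have hℓ := M.ℓ₂_pos; have hℓ1 := M.ℓ₁_pos; have hp := sqrt_pi_pos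
  have h : √(M.k₂ * M.c₁ / (M.k₁ * M.c₂)) = M.k₂ / (M.c₂ * √M.α₂ * M.ρ * √M.α₁) := by
    rw [Real.sqrt_eq_iff_eq_sq (by positivity) (by positivity), div_pow, mul_pow, mul_pow, mul_pow,
      Real.sq_sqrt M.α₁_pos.le, Real.sq_sqrt M.α₂_pos.le, α₁, α₂]
    field_simp
  rw [coeffH, h, Ste₂]
  field_simp

lemma Ste₁_eq : M.Ste₁ = M.k₁ * (M.C - M.D) / (√M.α₁ * (M.ρ * M.ℓ₁) * √M.α₁) := by
  have hk1 := M.k₁_pos; have hc1 := M.c₁_pos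
  have hρ := M.ρ_pos; have hℓ1 := M.ℓ₁_pos
  rw [Ste₁, mul_right_comm (√M.α₁), Real.mul_self_sqrt M.α₁_pos.le, α₁]
  field_simp

variable {M}

/-- The jump of the error function across the second phase. -/
def jump (M : Data) (ξ₁ ξ₂ : ℝ) : ℝ := erf (ξ₁ * √(M.α₁ / M.α₂)) - erf (ξ₂ * √(M.α₁ / M.α₂))

lemma jump_pos {ξ₁ ξ₂ : ℝ} (h : ξ₂ < ξ₁) : 0 < M.jump ξ₁ ξ₂ :=
  sub_pos.2 (strictMono_erf (mul_lt_mul_of_pos_right h M.ratio₂_pos))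

/-- Both sides carry the factor `ρ ℓ₁ √α₁ / √t`, so time drops out. What is left is `jump * φ ξ₁ =
coeffH * exp (-ξ₁² α₁/α₂)`, a rearrangement of the definition of `H`. -/
lemma stefan₁_iff {ξ₁ ξ₂ t : ℝ} (h1 : 0 < ξ₁) (h12 : ξ₂ < ξ₁) (ht : 0 < t) :
    M.k₁ * (-((M.C - M.D) / erfc ξ₁) * Real.exp (-ξ₁ ^ 2 * (M.α₁ / M.α₁)) /
        (√π * √M.α₁ * √t)) -
      M.k₂ * (-((M.B - M.C) / M.jump ξ₁ ξ₂) * Real.exp (-ξ₁ ^ 2 * (M.α₁ / M.α₂)) /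
        (√π * √M.α₂ * √t)) = M.δ₁ * (ξ₁ * √M.α₁ / √t) ↔
    erf (ξ₂ * √(M.α₁ / M.α₂)) = M.H ξ₁ := by
  obtain ⟨ha1, ha2, -⟩ := M.sqrt_α_facts
  have hρ := M.ρ_pos
  have hℓ1 := M.ℓ₁_pos
  have hp := sqrt_pi_pos
  have hs := Real.sqrt_pos.2 ht
  have hj := M.jump_pos h12
  have he := erfc_pos ξ₁
  have hφ := M.φ_pos h1.le
  have hJ : erf (ξ₂ * √(M.α₁ / M.α₂)) = erf (ξ₁ * √(M.α₁ / M.α₂)) - M.jump ξ₁ ξ₂ := by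
    rw [jump]
    ring
  have hk : 0 < M.ρ * M.ℓ₁ * √M.α₁ / √t := by positivity
  have hlhs : M.k₁ * (-((M.C - M.D) / erfc ξ₁) * Real.exp (-ξ₁ ^ 2 * (M.α₁ / M.α₁)) /
        (√π * √M.α₁ * √t)) -
      M.k₂ * (-((M.B - M.C) / M.jump ξ₁ ξ₂) * Real.exp (-ξ₁ ^ 2 * (M.α₁ / M.α₂)) /
        (√π * √M.α₂ * √t)) = M.ρ * M.ℓ₁ * √M.α₁ / √t *
      (-(M.φ ξ₁ - ξ₁) + M.coeffH * Real.exp (-ξ₁ ^ 2 * (M.α₁ / M.α₂)) / M.jump ξ₁ ξ₂) := by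
    rw [φ, Ste₁_eq, coeffH_eq, div_self M.α₁_pos.ne', mul_one]
    field_simp
    ring
  have hrhs : M.δ₁ * (ξ₁ * √M.α₁ / √t) = M.ρ * M.ℓ₁ * √M.α₁ / √t * ξ₁ := by
    rw [δ₁]
    ring
  rw [hlhs, hrhs, mul_right_inj' hk.ne', H_eq, hJ, sub_right_inj]
  constructor
  · intro h
    have h' : M.coeffH * Real.exp (-ξ₁ ^ 2 * (M.α₁ / M.α₂)) / M.jump ξ₁ ξ₂ = M.φ ξ₁ := by
      linarith
    rw [← h', div_div_eq_mul_div]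
    have := M.coeffH_pos
    have := Real.exp_pos (-ξ₁ ^ 2 * (M.α₁ / M.α₂))
    field_simp
  · intro h
    have h' : M.coeffH * Real.exp (-ξ₁ ^ 2 * (M.α₁ / M.α₂)) / M.jump ξ₁ ξ₂ = M.φ ξ₁ := by
      rw [div_eq_iff hj.ne', h]
      field_simp
    linarith

/-- The condition at `y₁` makes `jump` a multiple of `exp (-ξ₁² α₁/α₂) / φ ξ₁`, the reciprocal of
the product in `Q`. Thus `Q` measures the flux of the second phase. -/
lemma Q_eq_div_jump {ξ₁ ξ₂ : ℝ} (h1 : 0 < ξ₁) (hH : erf (ξ₂ * √(M.α₁ / M.α₂)) = M.H ξ₁) :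
    M.Q ξ₁ = M.ℓ₁ / M.ℓ₂ * M.coeffH / M.jump ξ₁ ξ₂ := by
  have hℓ2 := M.ℓ₂_pos
  have hφ := M.φ_pos h1.le
  have hJ : M.jump ξ₁ ξ₂ = M.coeffH * (Real.exp (-ξ₁ ^ 2 * (M.α₁ / M.α₂)) / M.φ ξ₁) := by
    rw [jump, hH, H_eq]
    ring
  have := M.coeffH_pos
  rw [Q, hJ, neg_mul, Real.exp_neg]
  have := Real.exp_pos (ξ₁ ^ 2 * (M.α₁ / M.α₂))
  field_simp

/-- Dividing by `ρ ℓ₂ √α₁ / √t * exp (-ξ₂² α₁/α₂)` removes time and turns the flux of the second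
phase into `-Q ξ₁`. -/
lemma stefan₂_iff {ξ₁ ξ₂ t P : ℝ} (h1 : 0 < ξ₁) (h12 : ξ₂ < ξ₁) (ht : 0 < t)
    (hH : erf (ξ₂ * √(M.α₁ / M.α₂)) = M.H ξ₁) :
    M.k₂ * (-((M.B - M.C) / M.jump ξ₁ ξ₂) * Real.exp (-ξ₂ ^ 2 * (M.α₁ / M.α₂)) /
        (√π * √M.α₂ * √t)) -
      M.k₃ * (-P * Real.exp (-ξ₂ ^ 2 * (M.α₁ / M.α₃)) / (√π * √M.α₃ * √t)) =
        M.δ₂ * (ξ₂ * √M.α₁ / √t) ↔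
    M.Q ξ₁ = M.coeffW * P * Real.exp (-ξ₂ ^ 2 * (M.α₁ / M.α₃ - M.α₁ / M.α₂)) -
      ξ₂ * Real.exp (ξ₂ ^ 2 * (M.α₁ / M.α₂)) := by
  obtain ⟨ha1, ha2, ha3⟩ := M.sqrt_α_facts
  have hρ := M.ρ_pos
  have hℓ1 := M.ℓ₁_pos
  have hℓ2 := M.ℓ₂_pos
  have hp := sqrt_pi_pos
  have hs := Real.sqrt_pos.2 ht
  have hj := M.jump_pos h12
  have hQ := Q_eq_div_jump h1 hH
  have hexp : Real.exp (-ξ₂ ^ 2 * (M.α₁ / M.α₃)) =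
      Real.exp (-ξ₂ ^ 2 * (M.α₁ / M.α₃ - M.α₁ / M.α₂)) *
        Real.exp (-ξ₂ ^ 2 * (M.α₁ / M.α₂)) := by
    rw [← Real.exp_add]
    ring_nf
  have hinv : Real.exp (ξ₂ ^ 2 * (M.α₁ / M.α₂)) * Real.exp (-ξ₂ ^ 2 * (M.α₁ / M.α₂)) = 1 := by
    rw [← Real.exp_add, neg_mul, add_neg_cancel, Real.exp_zero]
  have hE := Real.exp_pos (-ξ₂ ^ 2 * (M.α₁ / M.α₂))
  have hk : 0 < M.ρ * M.ℓ₂ * √M.α₁ / √t * Real.exp (-ξ₂ ^ 2 * (M.α₁ / M.α₂)) := by positivity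
  have hlhs : M.k₂ * (-((M.B - M.C) / M.jump ξ₁ ξ₂) * Real.exp (-ξ₂ ^ 2 * (M.α₁ / M.α₂)) /
        (√π * √M.α₂ * √t)) -
      M.k₃ * (-P * Real.exp (-ξ₂ ^ 2 * (M.α₁ / M.α₃)) / (√π * √M.α₃ * √t)) =
      M.ρ * M.ℓ₂ * √M.α₁ / √t * Real.exp (-ξ₂ ^ 2 * (M.α₁ / M.α₂)) *
        (-M.Q ξ₁ + M.coeffW * P * Real.exp (-ξ₂ ^ 2 * (M.α₁ / M.α₃ - M.α₁ / M.α₂))) := by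
    rw [hQ, coeffH_eq, coeffW_eq, hexp]
    field_simp
    ring
  have hrhs : M.δ₂ * (ξ₂ * √M.α₁ / √t) =
      M.ρ * M.ℓ₂ * √M.α₁ / √t * Real.exp (-ξ₂ ^ 2 * (M.α₁ / M.α₂)) *
        (ξ₂ * Real.exp (ξ₂ ^ 2 * (M.α₁ / M.α₂))) := by
    rw [δ₂]
    linear_combination (-(M.ρ * M.ℓ₂ * √M.α₁ / √t * ξ₂)) * hinv
  rw [hlhs, hrhs, mul_right_inj' hk.ne']
  constructor <;> intro h <;> linarith

end Data

namespace Data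

variable {M : Data}

/-! ### The similarity profiles -/

/-- The candidate with free boundary coefficients `ξ₁`, `ξ₂` that satisfies all temperature
conditions at the free boundaries and at infinity; `P` is the slope of the temperature of the third
phase in terms of the error function. -/
def profile (M : Data) (ξ₁ ξ₂ P : ℝ) : Candidate where
  Φ₃ := temp M.α₃ (M.B + P * erf (ξ₂ * √(M.α₁ / M.α₃))) (-P)
  Φ₂ := temp M.α₂ (M.C + (M.B - M.C) / M.jump ξ₁ ξ₂ * erf (ξ₁ * √(M.α₁ / M.α₂)))
    (-((M.B - M.C) / M.jump ξ₁ ξ₂))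
  Φ₁ := temp M.α₁ (M.D + (M.C - M.D) / erfc ξ₁) (-((M.C - M.D) / erfc ξ₁))
  y₁ t := 2 * ξ₁ * √(M.α₁ * t)
  y₂ t := 2 * ξ₂ * √(M.α₁ * t)

lemma sqrt_α₁_mul_pos {t : ℝ} (ht : 0 < t) : 0 < √(M.α₁ * t) :=
  Real.sqrt_pos.2 (mul_pos M.α₁_pos ht)

lemma front_lt {ξ η t : ℝ} (ht : 0 < t) : 2 * ξ * √(M.α₁ * t) < 2 * η * √(M.α₁ * t) ↔ ξ < η := by
  rw [mul_lt_mul_iff_left₀ (sqrt_α₁_mul_pos ht), mul_lt_mul_iff_right₀ two_pos]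

lemma front_pos {ξ t : ℝ} (ht : 0 < t) : 0 < 2 * ξ * √(M.α₁ * t) ↔ 0 < ξ := by
  simpa using front_lt (M := M) (ξ := 0) (η := ξ) ht

lemma sqrt_div_self_α₁ : √(M.α₁ / M.α₁) = 1 := by
  rw [div_self M.α₁_pos.ne', Real.sqrt_one]

lemma temp_front {a t : ℝ} (ha : 0 < a) (ht : 0 < t) (p q ξ : ℝ) :
    temp a p q (2 * ξ * √(M.α₁ * t)) t = p + q * erf (ξ * √(M.α₁ / a)) := by
  rw [temp, div_two_sqrt_eq ha M.α₁_pos ht]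

lemma tendsto_temp_atTop {a t : ℝ} (ha : 0 < a) (ht : 0 < t) (p q : ℝ) :
    Tendsto (fun x => temp a p q x t) atTop (𝓝 (p + q * 1)) :=
  ((tendsto_erf_atTop.comp (tendsto_id.atTop_div_const (two_sqrt_pos ha ht))).const_mul q).const_add
    p

lemma tendsto_temp_initial {a x : ℝ} (ha : 0 < a) (hx : 0 < x) (p q : ℝ) :
    Tendsto (fun t => temp a p q x t) (𝓝[>] 0) (𝓝 (p + q * 1)) := by
  have h1 : Tendsto (fun t => 2 * √(a * t)) (𝓝[>] 0) (𝓝[>] 0) := by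
    refine tendsto_nhdsWithin_iff.2 ⟨?_, ?_⟩
    · have hc : Continuous fun t => 2 * √(a * t) := by fun_prop
      have := hc.tendsto 0
      simp only [mul_zero, Real.sqrt_zero] at this
      exact this.mono_left nhdsWithin_le_nhds
    · filter_upwards [self_mem_nhdsWithin] with t ht
      exact two_sqrt_pos ha ht
  have h2 : Tendsto (fun t => x / (2 * √(a * t))) (𝓝[>] 0) atTop :=
    (tendsto_inv_nhdsGT_zero.comp h1).const_mul_atTop hx
  exact ((tendsto_erf_atTop.comp h2).const_mul q).const_add p

lemma isSimilarity_profile (ξ₁ ξ₂ P : ℝ) : M.IsSimilarity (M.profile ξ₁ ξ₂ P) :=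
  ⟨fun η => M.D + (M.C - M.D) / erfc ξ₁ + -((M.C - M.D) / erfc ξ₁) * erf η,
    fun η => M.C + (M.B - M.C) / M.jump ξ₁ ξ₂ * erf (ξ₁ * √(M.α₁ / M.α₂)) +
      -((M.B - M.C) / M.jump ξ₁ ξ₂) * erf η,
    fun η => M.B + P * erf (ξ₂ * √(M.α₁ / M.α₃)) + -P * erf η, ξ₁, ξ₂,
    fun _ _ => ⟨rfl, rfl, fun _ _ _ => rfl, fun _ _ _ => rfl, fun _ _ => rfl⟩⟩

section

variable {ξ₁ ξ₂ P : ℝ}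

lemma profile_Φ₃_front (M : Data) (ξ₁ ξ₂ P : ℝ) {t : ℝ} (ht : 0 < t) :
    (M.profile ξ₁ ξ₂ P).Φ₃ (2 * ξ₂ * √(M.α₁ * t)) t = M.B := by
  refine (temp_front M.α₃_pos ht _ _ _).trans ?_
  ring

lemma profile_Φ₂_front₂ (h12 : ξ₂ < ξ₁) {t : ℝ} (ht : 0 < t) :
    (M.profile ξ₁ ξ₂ P).Φ₂ (2 * ξ₂ * √(M.α₁ * t)) t = M.B := by
  have h : (M.B - M.C) / M.jump ξ₁ ξ₂ * M.jump ξ₁ ξ₂ = M.B - M.C :=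
    div_mul_cancel₀ _ (jump_pos h12).ne'
  refine (temp_front M.α₂_pos ht _ _ _).trans ?_
  nth_rewrite 2 [jump] at h
  linarith

lemma profile_Φ₂_front₁ (M : Data) (ξ₁ ξ₂ P : ℝ) {t : ℝ} (ht : 0 < t) :
    (M.profile ξ₁ ξ₂ P).Φ₂ (2 * ξ₁ * √(M.α₁ * t)) t = M.C := by
  refine (temp_front M.α₂_pos ht _ _ _).trans ?_
  ring

lemma profile_Φ₁_front (M : Data) (ξ₁ ξ₂ P : ℝ) {t : ℝ} (ht : 0 < t) :
    (M.profile ξ₁ ξ₂ P).Φ₁ (2 * ξ₁ * √(M.α₁ * t)) t = M.C := by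
  have h : (M.C - M.D) / erfc ξ₁ * erfc ξ₁ = M.C - M.D := div_mul_cancel₀ _ (erfc_pos ξ₁).ne'
  refine (temp_front M.α₁_pos ht _ _ _).trans ?_
  rw [sqrt_div_self_α₁, mul_one]
  nth_rewrite 2 [erfc] at h
  linarith

/-- A profile solves the Stefan problem as soon as its coefficients satisfy the two equations
coming from the Stefan conditions. -/
lemma isStefan_profile (h2 : 0 < ξ₂) (h12 : ξ₂ < ξ₁)
    (hH : erf (ξ₂ * √(M.α₁ / M.α₂)) = M.H ξ₁)
    (hQ : M.Q ξ₁ = M.coeffW * P * Real.exp (-ξ₂ ^ 2 * (M.α₁ / M.α₃ - M.α₁ / M.α₂)) -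
      ξ₂ * Real.exp (ξ₂ ^ 2 * (M.α₁ / M.α₂))) : M.IsStefan (M.profile ξ₁ ξ₂ P) where
  ordered t ht := ⟨(front_pos ht).2 h2, (front_lt ht).2 h12⟩
  cont_y₁ := Continuous.continuousOn (by simp only [profile]; fun_prop)
  cont_y₂ := Continuous.continuousOn (by simp only [profile]; fun_prop)
  start := by simp [profile]
  cont_Φ₃ := (continuousOn_temp M.α₃_pos _ _).mono fun _ h => h.1
  cont_Φ₂ := (continuousOn_temp M.α₂_pos _ _).mono fun _ h => h.1
  cont_Φ₁ := (continuousOn_temp M.α₁_pos _ _).mono fun _ h => h.1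
  heat₃ _ _ ht _ _ := heatAt_temp M.α₃_pos ht _ _ _
  heat₂ _ _ ht _ _ := heatAt_temp M.α₂_pos ht _ _ _
  heat₁ _ _ ht _ := heatAt_temp M.α₁_pos ht _ _ _
  temp_y₂ _ ht := ⟨profile_Φ₃_front M _ _ _ ht, profile_Φ₂_front₂ h12 ht⟩
  temp_y₁ _ ht := ⟨profile_Φ₂_front₁ M _ _ _ ht, profile_Φ₁_front M _ _ _ ht⟩
  initial x hx := by
    have h := tendsto_temp_initial M.α₁_pos hx (M.D + (M.C - M.D) / erfc ξ₁)
      (-((M.C - M.D) / erfc ξ₁))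
    rwa [mul_one, add_neg_cancel_right] at h
  infinity t ht := by
    have h := tendsto_temp_atTop M.α₁_pos ht (M.D + (M.C - M.D) / erfc ξ₁)
      (-((M.C - M.D) / erfc ξ₁))
    rwa [mul_one, add_neg_cancel_right] at h
  stefan₂ t ht := ⟨_, _, _,
    (hasDerivAt_temp_front M.α₂_pos M.α₁_pos ht _ _ _).hasDerivWithinAt,
    (hasDerivAt_temp_front M.α₃_pos M.α₁_pos ht _ _ _).hasDerivWithinAt,
    hasDerivAt_front M.α₁_pos ht _, (stefan₂_iff (h2.trans h12) h12 ht hH).2 hQ⟩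
  stefan₁ t ht := ⟨_, _, _,
    (hasDerivAt_temp_front M.α₁_pos M.α₁_pos ht _ _ _).hasDerivWithinAt,
    (hasDerivAt_temp_front M.α₂_pos M.α₁_pos ht _ _ _).hasDerivWithinAt,
    hasDerivAt_front M.α₁_pos ht _, (stefan₁_iff (h2.trans h12) h12 ht).2 hH⟩

end

/-- Every similarity solution of the Stefan problem coincides with a profile. -/
lemma IsStefan.exists_coincide_profile {S : Candidate} (hS : M.IsStefan S)
    (hsim : M.IsSimilarity S) :
    ∃ ξ₁ ξ₂ P, 0 < ξ₂ ∧ ξ₂ < ξ₁ ∧ S.Coincide (M.profile ξ₁ ξ₂ P) := by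
  obtain ⟨f₁, f₂, f₃, ξ₁, ξ₂, h⟩ := hsim
  have hy1 : ∀ t, 0 < t → S.y₁ t = 2 * ξ₁ * √(M.α₁ * t) := fun t ht => (h t ht).1
  have hy2 : ∀ t, 0 < t → S.y₂ t = 2 * ξ₂ * √(M.α₁ * t) := fun t ht => (h t ht).2.1
  have hξ2 : 0 < ξ₂ := by
    have := (hS.ordered 1 one_pos).1
    rwa [hy2 1 one_pos, front_pos one_pos] at this
  have hξ12 : ξ₂ < ξ₁ := by
    have := (hS.ordered 1 one_pos).2
    rwa [hy1 1 one_pos, hy2 1 one_pos, front_lt one_pos] at this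
  -- In its own similarity variable each moving phase is a fixed interval.
  have mem3 : ∀ t, 0 < t → ∀ x,
      x / (2 * √(M.α₃ * t)) ∈ Icc 0 (ξ₂ * √(M.α₁ / M.α₃)) ↔ 0 ≤ x ∧ x ≤ S.y₂ t := by
    intro t ht x
    rw [mem_Icc, div_two_sqrt_le_iff M.α₃_pos M.α₁_pos ht, hy2 t ht,
      le_div_iff₀ (two_sqrt_pos M.α₃_pos ht), zero_mul]
  have mem2 : ∀ t, 0 < t → ∀ x,
      x / (2 * √(M.α₂ * t)) ∈ Icc (ξ₂ * √(M.α₁ / M.α₂)) (ξ₁ * √(M.α₁ / M.α₂)) ↔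
        S.y₂ t ≤ x ∧ x ≤ S.y₁ t := by
    intro t ht x
    rw [mem_Icc, div_two_sqrt_le_iff M.α₂_pos M.α₁_pos ht,
      le_div_two_sqrt_iff M.α₂_pos M.α₁_pos ht, hy1 t ht, hy2 t ht]
  have mem1 : ∀ t, 0 < t → ∀ x,
      x / (2 * √(M.α₁ * t)) ∈ Ici (ξ₁ * √(M.α₁ / M.α₁)) ↔ S.y₁ t ≤ x := by
    intro t ht x
    rw [mem_Ici, le_div_two_sqrt_iff M.α₁_pos M.α₁_pos ht, hy1 t ht]
  have hne3 : 0 < ξ₂ * √(M.α₁ / M.α₃) := mul_pos hξ2 M.ratio₃_pos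
  have hne2 : ξ₂ * √(M.α₁ / M.α₂) < ξ₁ * √(M.α₁ / M.α₂) :=
    mul_lt_mul_of_pos_right hξ12 M.ratio₂_pos
  obtain ⟨p₃, q₃, h3⟩ := exists_erf_profile (Φ := S.Φ₃) (f := f₃) M.α₃_pos
    (J := Icc 0 (ξ₂ * √(M.α₁ / M.α₃)))
    (by rw [interior_Icc]; exact isPreconnected_Ioo)
    (by rw [interior_Icc, closure_Ioo hne3.ne])
    (fun t ht x hx => (h t ht).2.2.1 x ((mem3 t ht x).1 hx).1 ((mem3 t ht x).1 hx).2)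
    (fun t ht x hx => by
      have hx' := ((mem3 t ht x).1 (interior_subset hx)).2
      rw [interior_Icc, mem_Ioo, lt_div_iff₀ (two_sqrt_pos M.α₃_pos ht), zero_mul] at hx
      refine hS.heat₃ x t ht hx.1 (hx'.lt_of_ne ?_)
      rintro rfl
      rw [hy2 t ht, div_two_sqrt_eq M.α₃_pos M.α₁_pos ht] at hx
      exact lt_irrefl _ hx.2)
    (fun t ht => hS.cont_Φ₃.comp (f := fun x : ℝ => (x, t)) (by fun_prop)
      fun x hx => ⟨ht, (mem3 t ht x).1 hx⟩)
  obtain ⟨p₂, q₂, h2⟩ := exists_erf_profile (Φ := S.Φ₂) (f := f₂) M.α₂_pos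
    (J := Icc (ξ₂ * √(M.α₁ / M.α₂)) (ξ₁ * √(M.α₁ / M.α₂)))
    (by rw [interior_Icc]; exact isPreconnected_Ioo)
    (by rw [interior_Icc, closure_Ioo hne2.ne])
    (fun t ht x hx => (h t ht).2.2.2.1 x ((mem2 t ht x).1 hx).1 ((mem2 t ht x).1 hx).2)
    (fun t ht x hx => by
      rw [interior_Icc, mem_Ioo, ← not_le, ← not_le, div_two_sqrt_le_iff M.α₂_pos M.α₁_pos ht,
        le_div_two_sqrt_iff M.α₂_pos M.α₁_pos ht, not_le, not_le, ← hy1 t ht, ← hy2 t ht] at hx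
      exact hS.heat₂ x t ht hx.1 hx.2)
    (fun t ht => hS.cont_Φ₂.comp (f := fun x : ℝ => (x, t)) (by fun_prop)
      fun x hx => ⟨ht, (mem2 t ht x).1 hx⟩)
  obtain ⟨p₁, q₁, h1⟩ := exists_erf_profile (Φ := S.Φ₁) (f := f₁) M.α₁_pos
    (J := Ici (ξ₁ * √(M.α₁ / M.α₁)))
    (by rw [interior_Ici]; exact isPreconnected_Ioi)
    (by rw [interior_Ici, closure_Ioi])
    (fun t ht x hx => (h t ht).2.2.2.2 x ((mem1 t ht x).1 hx))
    (fun t ht x hx => by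
      rw [interior_Ici, mem_Ioi, ← not_le, div_two_sqrt_le_iff M.α₁_pos M.α₁_pos ht, not_le,
        ← hy1 t ht] at hx
      exact hS.heat₁ x t ht hx)
    (fun t ht => hS.cont_Φ₁.comp (f := fun x : ℝ => (x, t)) (by fun_prop)
      fun x hx => ⟨ht, (mem1 t ht x).1 hx⟩)
  obtain ⟨hy2pos, hy21⟩ := hS.ordered 1 one_pos
  -- These five relations fix all constants except `q₃`, which remains as `P = -q₃`. By
  -- self-similarity the time `1` suffices.
  have hB3 : p₃ + q₃ * erf (ξ₂ * √(M.α₁ / M.α₃)) = M.B := by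
    rw [← temp_front M.α₃_pos one_pos, ← hy2 1 one_pos,
      ← h3 1 one_pos _ ((mem3 1 one_pos _).2 ⟨hy2pos.le, le_rfl⟩)]
    exact (hS.temp_y₂ 1 one_pos).1
  have hB2 : p₂ + q₂ * erf (ξ₂ * √(M.α₁ / M.α₂)) = M.B := by
    rw [← temp_front M.α₂_pos one_pos, ← hy2 1 one_pos,
      ← h2 1 one_pos _ ((mem2 1 one_pos _).2 ⟨le_rfl, hy21.le⟩)]
    exact (hS.temp_y₂ 1 one_pos).2
  have hC2 : p₂ + q₂ * erf (ξ₁ * √(M.α₁ / M.α₂)) = M.C := by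
    rw [← temp_front M.α₂_pos one_pos, ← hy1 1 one_pos,
      ← h2 1 one_pos _ ((mem2 1 one_pos _).2 ⟨hy21.le, le_rfl⟩)]
    exact (hS.temp_y₁ 1 one_pos).1
  have hC1 : p₁ + q₁ * erf ξ₁ = M.C := by
    have h := temp_front (M := M) M.α₁_pos one_pos p₁ q₁ ξ₁
    rw [sqrt_div_self_α₁, mul_one ξ₁] at h
    rw [← h, ← hy1 1 one_pos, ← h1 1 one_pos _ ((mem1 1 one_pos _).2 le_rfl)]
    exact (hS.temp_y₁ 1 one_pos).2
  have hD1 : p₁ + q₁ * 1 = M.D := by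
    refine tendsto_nhds_unique ((tendsto_temp_atTop M.α₁_pos one_pos p₁ q₁).congr' ?_)
      (hS.infinity 1 one_pos)
    filter_upwards [eventually_ge_atTop (S.y₁ 1)] with x hx
    exact (h1 1 one_pos x ((mem1 1 one_pos x).2 hx)).symm
  have hj := (M.jump_pos hξ12).ne'
  have he := (erfc_pos ξ₁).ne'
  have hq2 : q₂ = -((M.B - M.C) / M.jump ξ₁ ξ₂) := by
    rw [← neg_div, eq_div_iff hj, jump]
    linarith
  have hq1 : q₁ = -((M.C - M.D) / erfc ξ₁) := by
    rw [← neg_div, eq_div_iff he, erfc]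
    linarith
  refine ⟨ξ₁, ξ₂, -q₃, hξ2, hξ12, fun t ht => ?_, fun t ht => ⟨fun x hx hx' => ?_,
    fun x hx hx' => ?_, fun x hx => ?_⟩⟩
  · rcases ht.eq_or_lt with rfl | ht
    · simp [profile, hS.start]
    · exact ⟨hy1 t ht, hy2 t ht⟩
  · rw [h3 t ht x ((mem3 t ht x).2 ⟨hx, hx'⟩), profile, neg_neg]
    congr 1
    linarith
  · rw [h2 t ht x ((mem2 t ht x).2 ⟨hx, hx'⟩), profile, ← hq2]
    congr 1
    linear_combination hC2 - erf (ξ₁ * √(M.α₁ / M.α₂)) * hq2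
  · rw [h1 t ht x ((mem1 t ht x).2 hx), profile, ← hq1]
    congr 1
    linear_combination hD1 - hq1

/-- Transfers one-sided derivatives at a front from the explicit profile to an arbitrary solution
that agrees with it only inside the phase. -/
lemma _root_.HasDerivWithinAt.eq_of_eqOn {f g : ℝ → ℝ} {s : Set ℝ} {x p d : ℝ}
    (h : HasDerivWithinAt f p s x) (hu : UniqueDiffWithinAt ℝ s x) (hfg : EqOn f g s)
    (hx : x ∈ s) (hg : HasDerivAt g d x) : p = d :=
  hu.eq_deriv _ h (hg.hasDerivWithinAt.congr_of_mem hfg hx)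

/-- The equations for the coefficients of a solution that coincides with a profile. -/
lemma IsStefan.equations {S : Candidate} (hS : M.IsStefan S) {ξ₁ ξ₂ P : ℝ} (h2 : 0 < ξ₂)
    (h12 : ξ₂ < ξ₁) (hc : S.Coincide (M.profile ξ₁ ξ₂ P)) :
    erf (ξ₂ * √(M.α₁ / M.α₂)) = M.H ξ₁ ∧
      M.Q ξ₁ = M.coeffW * P * Real.exp (-ξ₂ ^ 2 * (M.α₁ / M.α₃ - M.α₁ / M.α₂)) -
        ξ₂ * Real.exp (ξ₂ ^ 2 * (M.α₁ / M.α₂)) := by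
  obtain ⟨hy, hΦ⟩ := hc
  obtain ⟨hc3, hc2, hc1⟩ := hΦ 1 one_pos
  obtain ⟨hy1, hy2⟩ := hy 1 zero_le_one
  obtain ⟨hy2pos, hy21⟩ := hS.ordered 1 one_pos
  change S.y₁ 1 = 2 * ξ₁ * √(M.α₁ * 1) at hy1
  change S.y₂ 1 = 2 * ξ₂ * √(M.α₁ * 1) at hy2
  have hv1 : HasDerivAt S.y₁ (ξ₁ * √M.α₁ / √1) 1 :=
    (hasDerivAt_front M.α₁_pos one_pos ξ₁).congr_of_eventuallyEq <| by
      filter_upwards [lt_mem_nhds one_pos] with t ht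
      exact (hy t ht.le).1
  have hv2 : HasDerivAt S.y₂ (ξ₂ * √M.α₁ / √1) 1 :=
    (hasDerivAt_front M.α₁_pos one_pos ξ₂).congr_of_eventuallyEq <| by
      filter_upwards [lt_mem_nhds one_pos] with t ht
      exact (hy t ht.le).2
  have hH : erf (ξ₂ * √(M.α₁ / M.α₂)) = M.H ξ₁ := by
    obtain ⟨p₁, p₂, v, hp1, hp2, hv, heq⟩ := hS.stefan₁ 1 one_pos
    have e1 := hp1.eq_of_eqOn (uniqueDiffOn_Ici _ _ self_mem_Ici) (fun x hx => hc1 x hx)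
      self_mem_Ici (by
        rw [hy1]
        exact hasDerivAt_temp_front M.α₁_pos M.α₁_pos one_pos _ _ ξ₁)
    have e2 := hp2.eq_of_eqOn (uniqueDiffOn_Icc hy21 _ (right_mem_Icc.2 hy21.le))
      (fun x hx => hc2 x hx.1 hx.2) (right_mem_Icc.2 hy21.le) (by
        rw [hy1]
        exact hasDerivAt_temp_front M.α₂_pos M.α₁_pos one_pos _ _ ξ₁)
    rw [e1, e2, hv.unique hv1] at heq
    exact (stefan₁_iff (h2.trans h12) h12 one_pos).1 heq
  refine ⟨hH, ?_⟩
  obtain ⟨p₂, p₃, v, hp2, hp3, hv, heq⟩ := hS.stefan₂ 1 one_pos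
  have e2 := hp2.eq_of_eqOn (uniqueDiffOn_Icc hy21 _ (left_mem_Icc.2 hy21.le))
    (fun x hx => hc2 x hx.1 hx.2) (left_mem_Icc.2 hy21.le) (by
      rw [hy2]
      exact hasDerivAt_temp_front M.α₂_pos M.α₁_pos one_pos _ _ ξ₂)
  have e3 := hp3.eq_of_eqOn (uniqueDiffOn_Icc hy2pos _ (right_mem_Icc.2 hy2pos.le))
    (fun x hx => hc3 x hx.1 hx.2) (right_mem_Icc.2 hy2pos.le) (by
      rw [hy2]
      exact hasDerivAt_temp_front M.α₃_pos M.α₁_pos one_pos _ _ ξ₂)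
  rw [e2, e3, hv.unique hv2] at heq
  exact (stefan₂_iff (h2.trans h12) h12 one_pos hH).1 heq

/-! ### The conditions at the fixed face -/

lemma coincide_refl (S : Candidate) : S.Coincide S :=
  ⟨fun _ _ => ⟨rfl, rfl⟩, fun _ _ => ⟨fun _ _ _ => rfl, fun _ _ _ => rfl, fun _ _ => rfl⟩⟩

section

variable {S : Candidate} {ξ₁ ξ₂ P : ℝ}

lemma Φ₃_zero (h2 : 0 < ξ₂) (hc : S.Coincide (M.profile ξ₁ ξ₂ P)) {t : ℝ} (ht : 0 < t) :
    S.Φ₃ 0 t = M.B + P * erf (ξ₂ * √(M.α₁ / M.α₃)) := by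
  have hy : 0 < S.y₂ t := by
    rw [(hc.1 t ht.le).2]
    exact (front_pos ht).2 h2
  rw [(hc.2 t ht).1 0 le_rfl hy.le]
  simp [profile, temp, erf_zero]

/-- The summand `0` gives the condition the same shape as the convective one. -/
lemma dirichletCondition_iff (h2 : 0 < ξ₂) (hc : S.Coincide (M.profile ξ₁ ξ₂ P)) {A : ℝ} :
    DirichletCondition A S ↔ P * (0 + erf (ξ₂ * √(M.α₁ / M.α₃))) = A - M.B := by
  rw [zero_add]
  constructor
  · intro h
    have := h 1 one_pos
    rw [Φ₃_zero h2 hc one_pos] at this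
    linarith
  · intro h t ht
    rw [Φ₃_zero h2 hc ht]
    linarith

/-- The flux of a profile at the face scales like `1/√t`, as does the transfer coefficient, so one
equation covers all times. -/
lemma robinCondition_iff (h2 : 0 < ξ₂) (hc : S.Coincide (M.profile ξ₁ ξ₂ P)) {h₀ Ainf : ℝ}
    (hh : 0 < h₀) :
    M.RobinCondition h₀ Ainf S ↔
      P * (M.k₃ / (h₀ * √(π * M.α₃)) + erf (ξ₂ * √(M.α₁ / M.α₃))) = Ainf - M.B := by
  have hd : ∀ t, 0 < t → HasDerivAt (fun x => (M.profile ξ₁ ξ₂ P).Φ₃ x t)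
      (-P / (√π * √M.α₃ * √t)) 0 := by
    intro t ht
    -- The fixed face is treated as a front with coefficient `0`.
    have h := hasDerivAt_temp_front M.α₃_pos M.α₁_pos ht
      (M.B + P * erf (ξ₂ * √(M.α₁ / M.α₃))) (-P) 0
    simp only [mul_zero, zero_mul, ne_eq, OfNat.ofNat_ne_zero, not_false_eq_true, zero_pow,
      neg_zero, Real.exp_zero, mul_one] at h
    exact h
  have hy : ∀ t, 0 < t → 0 < S.y₂ t := fun t ht => by
    rw [(hc.1 t ht.le).2]
    exact (front_pos ht).2 h2
  have hiff : ∀ t, 0 < t → (M.k₃ * (-P / (√π * √M.α₃ * √t)) = h₀ / √t * (S.Φ₃ 0 t - Ainf) ↔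
      P * (M.k₃ / (h₀ * √(π * M.α₃)) + erf (ξ₂ * √(M.α₁ / M.α₃))) = Ainf - M.B) := by
    intro t ht
    have h1 := Real.sqrt_pos.2 ht
    have h3 := M.sqrt_α_facts.2.2
    have hp := sqrt_pi_pos
    have hk : 0 < h₀ / √t := by positivity
    have hl : M.k₃ * (-P / (√π * √M.α₃ * √t)) =
        h₀ / √t * (-(P * (M.k₃ / (h₀ * √(π * M.α₃))))) := by
      rw [Real.sqrt_mul Real.pi_pos.le]
      field_simp
    rw [Φ₃_zero h2 hc ht, hl, mul_right_inj' hk.ne']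
    constructor <;> intro h <;> linarith
  constructor
  · intro h
    obtain ⟨p, hp, heq⟩ := h 1 one_pos
    have hy1 := hy 1 one_pos
    rw [hp.eq_of_eqOn (uniqueDiffOn_Icc hy1 _ (left_mem_Icc.2 hy1.le))
      (fun x hx => (hc.2 1 one_pos).1 x hx.1 hx.2) (left_mem_Icc.2 hy1.le) (hd 1 one_pos)] at heq
    exact (hiff 1 one_pos).1 heq
  · intro h t ht
    exact ⟨_, (hd t ht).hasDerivWithinAt.congr_of_mem
      (fun x hx => (hc.2 t ht).1 x hx.1 hx.2) (left_mem_Icc.2 (hy t ht).le), (hiff t ht).2 h⟩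

end

/-! ### Existence and uniqueness of similarity solutions -/

/-- The right side involves `P` but neither `K` nor `d`. Hence the root equation passes between the
two problems whenever the same `P` satisfies both face conditions. -/
lemma eq_W_iff {K d P s q : ℝ} (hK : 0 ≤ K) (hs : 0 < s)
    (hP : P * (K + erf (s * √(M.α₁ / M.α₃))) = d) :
    q = M.W K (M.coeffW * d) s ↔
      q = M.coeffW * P * Real.exp (-s ^ 2 * (M.α₁ / M.α₃ - M.α₁ / M.α₂)) -
        s * Real.exp (s ^ 2 * (M.α₁ / M.α₂)) := by
  have h := add_erf_pos (M := M) hK hs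
  rw [W, ← hP]
  have : M.coeffW * (P * (K + erf (s * √(M.α₁ / M.α₃)))) *
      (Real.exp (-s ^ 2 * (M.α₁ / M.α₃ - M.α₁ / M.α₂)) / (K + erf (s * √(M.α₁ / M.α₃)))) =
      M.coeffW * P * Real.exp (-s ^ 2 * (M.α₁ / M.α₃ - M.α₁ / M.α₂)) := by
    field_simp
  rw [this]

section

variable {z₀ ξ K d P : ℝ}

lemma isStefan_of_root (h₀ : 0 < z₀) (hH : M.H z₀ = 0) (hξ : z₀ < ξ) (hK : 0 ≤ K)
    (hP : P * (K + erf (M.second ξ * √(M.α₁ / M.α₃))) = d)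
    (hQ : M.Q ξ = M.W K (M.coeffW * d) (M.second ξ)) :
    M.IsStefan (M.profile ξ (M.second ξ) P) :=
  isStefan_profile (second_pos h₀ hH hξ) (second_lt h₀ hH hξ.le) (erf_second h₀ hH hξ.le)
    ((eq_W_iff hK (second_pos h₀ hH hξ) hP).1 hQ)

lemma coincide_of_root (h₀ : 0 < z₀) (hH : M.H z₀ = 0) (hξ : z₀ < ξ) (hK : 0 ≤ K) (hd : 0 < d)
    (hP : P * (K + erf (M.second ξ * √(M.α₁ / M.α₃))) = d)
    (hQ : M.Q ξ = M.W K (M.coeffW * d) (M.second ξ)) {S : Candidate} (hS : M.IsStefan S)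
    (hsim : M.IsSimilarity S)
    (hcond : ∀ ξ₁ ξ₂ P', 0 < ξ₂ → S.Coincide (M.profile ξ₁ ξ₂ P') →
      P' * (K + erf (ξ₂ * √(M.α₁ / M.α₃))) = d) :
    S.Coincide (M.profile ξ (M.second ξ) P) := by
  obtain ⟨ξ₁, ξ₂, P', h2, h12, hc⟩ := hS.exists_coincide_profile hsim
  obtain ⟨e1, e2⟩ := hS.equations h2 h12 hc
  have hP' := hcond ξ₁ ξ₂ P' h2 hc
  have hs : M.second ξ₁ = ξ₂ := M.second_eq_of_erf_eq e1
  -- `H ξ₁` is the error function of a positive number, and `H` increases from its zero `z₀`.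
  have hz : z₀ < ξ₁ := by
    have : M.H z₀ < M.H ξ₁ := by
      rw [hH, ← e1]
      exact erf_pos (mul_pos h2 M.ratio₂_pos)
    exact (M.strictMonoOn_H.lt_iff_lt (mem_Ici.2 h₀.le) (mem_Ici.2 (h2.trans h12).le)).1 this
  have hQ' : M.Q ξ₁ = M.W K (M.coeffW * d) (M.second ξ₁) := by
    rw [hs]
    exact (eq_W_iff hK h2 hP').2 e2
  obtain rfl := root_unique h₀ hH hK (mul_pos M.coeffW_pos hd) hz hξ hQ' hQ
  rw [hs] at hP ⊢
  -- With equal front coefficients, the face condition forces equal slopes.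
  rwa [mul_right_cancel₀ (add_erf_pos hK h2).ne' (hP.trans hP'.symm)]

lemma isTheSolutionP2_profile {A : ℝ} (h₀ : 0 < z₀) (hH : M.H z₀ = 0) (hξ : z₀ < ξ)
    (hA : M.B < A) (hP : P * (0 + erf (M.second ξ * √(M.α₁ / M.α₃))) = A - M.B)
    (hQ : M.Q ξ = M.W 0 (M.coeffW * (A - M.B)) (M.second ξ)) :
    M.IsTheSolutionP2 A (M.profile ξ (M.second ξ) P) :=
  ⟨⟨isStefan_of_root h₀ hH hξ le_rfl hP hQ,
    (dirichletCondition_iff (second_pos h₀ hH hξ) (coincide_refl _)).2 hP,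
    isSimilarity_profile _ _ _⟩, fun _ hS => coincide_of_root h₀ hH hξ le_rfl (sub_pos.2 hA) hP hQ
      hS.1 hS.2.2 fun _ _ _ h2 hc => (dirichletCondition_iff h2 hc).1 hS.2.1⟩

lemma isTheSolutionP1_profile {h Ainf : ℝ} (h₀ : 0 < z₀) (hH : M.H z₀ = 0) (hξ : z₀ < ξ)
    (hA : M.B < Ainf) (hh : 0 < h)
    (hP : P * (M.k₃ / (h * √(π * M.α₃)) + erf (M.second ξ * √(M.α₁ / M.α₃))) = Ainf - M.B)
    (hQ : M.Q ξ =
      M.W (M.k₃ / (h * √(π * M.α₃))) (M.coeffW * (Ainf - M.B)) (M.second ξ)) :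
    M.IsTheSolutionP1 h Ainf (M.profile ξ (M.second ξ) P) := by
  have hK : 0 ≤ M.k₃ / (h * √(π * M.α₃)) :=
    div_nonneg M.k₃_pos.le (mul_nonneg hh.le (Real.sqrt_nonneg _))
  exact ⟨⟨isStefan_of_root h₀ hH hξ hK hP hQ,
    (robinCondition_iff (second_pos h₀ hH hξ) (coincide_refl _) hh).2 hP,
    isSimilarity_profile _ _ _⟩, fun _ hS => coincide_of_root h₀ hH hξ hK (sub_pos.2 hA) hP hQ
      hS.1 hS.2.2 fun _ _ _ h2 hc => (robinCondition_iff h2 hc hh).1 hS.2.1⟩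

end

end Data

namespace Data

variable {M : Data}

/-! ### The explicit solutions are profiles -/

lemma robinSolution_eq_profile {h Ainf ξ₁ ξ₂ : ℝ} (h12 : ξ₂ < ξ₁)
    (hd : 0 < M.k₃ / (h * √(π * M.α₃)) + erf (ξ₂ * √(M.α₁ / M.α₃))) :
    M.robinSolution h Ainf ξ₁ ξ₂ = M.profile ξ₁ ξ₂
      ((Ainf - M.B) / (M.k₃ / (h * √(π * M.α₃)) + erf (ξ₂ * √(M.α₁ / M.α₃)))) := by
  have hj := M.jump_pos h12
  have he := erfc_pos ξ₁
  rw [robinSolution, profile, Candidate.mk.injEq]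
  refine ⟨?_, ?_, ?_, rfl, rfl⟩ <;> funext x t <;> rw [temp]
  · rw [div_eq_iff he.ne', add_mul, add_mul, neg_mul, neg_mul, mul_right_comm,
      div_mul_cancel₀ _ he.ne', erfc]
    ring
  · change _ / M.jump ξ₁ ξ₂ = _
    rw [div_eq_iff hj.ne']
    have h : (M.B - M.C) / M.jump ξ₁ ξ₂ * M.jump ξ₁ ξ₂ = M.B - M.C := div_mul_cancel₀ _ hj.ne'
    have hJ : M.jump ξ₁ ξ₂ = erf (ξ₁ * √(M.α₁ / M.α₂)) - erf (ξ₂ * √(M.α₁ / M.α₂)) := rfl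
    linear_combination (-M.C) * hJ +
      (erf (x / (2 * √(M.α₂ * t))) - erf (ξ₁ * √(M.α₁ / M.α₂))) * h
  · rw [mul_div_assoc M.B]
    generalize M.k₃ / (h * √(π * M.α₃)) = K at hd ⊢
    field_simp
    ring

lemma dirichletSolution_eq_profile {A μ₁ μ₂ : ℝ} (h2 : 0 < μ₂) (h12 : μ₂ < μ₁) :
    M.dirichletSolution A μ₁ μ₂ =
      M.profile μ₁ μ₂ ((A - M.B) / erf (μ₂ * √(M.α₁ / M.α₃))) := by
  have hj := M.jump_pos h12
  have he := erfc_pos μ₁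
  have hE := erf_pos (mul_pos h2 M.ratio₃_pos)
  rw [dirichletSolution, profile, Candidate.mk.injEq]
  refine ⟨?_, ?_, ?_, rfl, rfl⟩ <;> funext x t <;> rw [temp]
  · rw [show erfc (x / (2 * √(M.α₁ * t))) = 1 - erf (x / (2 * √(M.α₁ * t))) from rfl]
    ring
  · change _ / M.jump μ₁ μ₂ = _
    rw [div_eq_iff hj.ne']
    have h : (M.B - M.C) / M.jump μ₁ μ₂ * M.jump μ₁ μ₂ = M.B - M.C := div_mul_cancel₀ _ hj.ne'
    have hJ : M.jump μ₁ μ₂ = erf (μ₁ * √(M.α₁ / M.α₂)) - erf (μ₂ * √(M.α₁ / M.α₂)) := rfl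
    linear_combination (-M.C) * hJ +
      (erf (x / (2 * √(M.α₂ * t))) - erf (μ₁ * √(M.α₁ / M.α₂))) * h
  · field_simp
    ring

/-! ### The functions `T` and `V` and the threshold for the heat transfer coefficient -/

lemma V_eq_W (A z : ℝ) : M.V A z = M.W 0 (M.coeffW * (A - M.B)) z := by
  rw [V, W, coeffW, zero_add]
  ring

lemma T_eq_W (h Ainf z : ℝ) :
    M.T h Ainf z = M.W (M.k₃ / (h * √(π * M.α₃))) (M.coeffW * (Ainf - M.B)) z := by
  have h1 : √(M.c₁ * M.c₃ * M.k₃ / (π * M.k₁)) = √(M.k₃ * M.c₁ * M.c₃ / M.k₁) / √π := by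
    rw [← Real.sqrt_div' _ Real.pi_pos.le]
    congr 1
    rw [div_div]
    ring
  have h2 : -z ^ 2 * M.α₁ * (1 / M.α₃ - 1 / M.α₂) = -z ^ 2 * (M.α₁ / M.α₃ - M.α₁ / M.α₂) := by
    ring
  have h3 : M.Ste₂ / (√π * M.c₂) * ((Ainf - M.B) / (M.B - M.C)) *
      √(M.k₃ * M.c₁ * M.c₃ / M.k₁) = M.coeffW * (Ainf - M.B) := by
    have := (sub_pos.2 M.C_lt_B).ne'
    have := M.c₂_pos
    have := M.ℓ₂_pos
    have := sqrt_pi_pos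
    rw [coeffW, h1, Ste₂]
    field_simp
  rw [T, W, h2, h3]

/-- Since `k₃ / (c₃ α₃) = ρ`, the data of the third phase cancel. -/
lemma h₂_eq (z₀ Ainf : ℝ) : M.h₂ z₀ Ainf = (M.B - M.C) / (Ainf - M.B) *
    (M.k₂ / (√π * √M.α₂)) * (1 / erf (z₀ * √(M.α₁ / M.α₂))) := by
  have h2 := M.sqrt_α_facts.2.1
  have hk2 := M.k₂_pos; have hk3 := M.k₃_pos; have hc2 := M.c₂_pos; have hc3 := M.c₃_pos
  have hρ := M.ρ_pos; have hπ := Real.pi_pos; have hp := sqrt_pi_pos; have ha3 := M.α₃_pos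
  have h : √(M.k₂ * M.k₃ * M.c₂ / (π * M.c₃ * M.α₃)) = M.k₂ / (√π * √M.α₂) := by
    rw [Real.sqrt_eq_iff_eq_sq (by positivity) (by positivity), div_pow, mul_pow,
      Real.sq_sqrt hπ.le, Real.sq_sqrt M.α₂_pos.le, α₂, α₃]
    field_simp
  rw [h₂, h]

lemma h₂_pos {z₀ Ainf : ℝ} (h₀ : 0 < z₀) (hA : M.B < Ainf) : 0 < M.h₂ z₀ Ainf := by
  have h2 := M.sqrt_α_facts.2.1
  have hk2 := M.k₂_pos
  have hp := sqrt_pi_pos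
  have hE := erf_pos (mul_pos h₀ M.ratio₂_pos)
  have hBC := sub_pos.2 M.C_lt_B
  have hAB := sub_pos.2 hA
  rw [h₂_eq]
  positivity

/-- At `z₀` the second front coefficient is `0`, so `Q z₀` is explicit, and the quotient of the two
sides is `h₂ / h`. This is where the threshold comes from. -/
lemma Q_zero_mul_lt {z₀ h Ainf : ℝ} (h₀ : 0 < z₀) (hH : M.H z₀ = 0) (hA : M.B < Ainf)
    (hh : M.h₂ z₀ Ainf < h) :
    M.Q z₀ * (M.k₃ / (h * √(π * M.α₃))) < M.coeffW * (Ainf - M.B) := by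
  obtain ⟨h1, h2, h3⟩ := M.sqrt_α_facts
  have hp := sqrt_pi_pos
  have hE := erf_pos (mul_pos h₀ M.ratio₂_pos)
  have hAB := sub_pos.2 hA
  have hh0 := (h₂_pos h₀ hA).trans hh
  have hρ := M.ρ_pos
  have hℓ1 := M.ℓ₁_pos
  have hℓ2 := M.ℓ₂_pos
  have hX := mul_pos M.coeffW_pos hAB
  have hQ : M.Q z₀ = M.ℓ₁ / M.ℓ₂ * M.coeffH / erf (z₀ * √(M.α₁ / M.α₂)) := by
    have := Q_eq_div_jump (M := M) (ξ₁ := z₀) (ξ₂ := 0) h₀ (by rw [zero_mul, erf_zero, hH])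
    rwa [jump, zero_mul, erf_zero, sub_zero] at this
  have heq : M.Q z₀ * (M.k₃ / (h * √(π * M.α₃))) =
      M.coeffW * (Ainf - M.B) * (M.h₂ z₀ Ainf / h) := by
    rw [hQ, h₂_eq, coeffH_eq, coeffW_eq, Real.sqrt_mul Real.pi_pos.le]
    field_simp
  rw [heq]
  exact mul_lt_of_lt_one_right hX ((div_lt_one hh0).2 hh)

end Data

end ThreePhase

end

/-! ### Equivalence of the convective and the temperature problem -/

theorem theorem3p1 (M : ThreePhase.Data) :
    (∃! z : ℝ, 0 < z ∧ M.H z = 0) ∧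
    ∀ z₀ : ℝ, 0 < z₀ → M.H z₀ = 0 →
      -- from the convective condition to the temperature condition
      (∀ h₀ Ainf : ℝ, M.B < Ainf → M.h₂ z₀ Ainf < h₀ →
        (∃! ξ₁ : ℝ, z₀ < ξ₁ ∧ M.Q ξ₁ = M.U h₀ Ainf ξ₁) ∧
        ∀ ξ₁ ξ₂ A : ℝ, z₀ < ξ₁ → M.Q ξ₁ = M.U h₀ Ainf ξ₁ → ξ₂ = M.second ξ₁ →
          A = M.wallTemperature h₀ Ainf ξ₂ → M.B < A →
          M.IsTheSolutionP1 h₀ Ainf (M.robinSolution h₀ Ainf ξ₁ ξ₂) ∧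
          M.IsTheSolutionP2 A (M.robinSolution h₀ Ainf ξ₁ ξ₂)) ∧
      -- from the temperature condition to the convective condition
      (∀ A : ℝ, M.B < A →
        (∃! μ₁ : ℝ, z₀ < μ₁ ∧ M.Q μ₁ = M.V A (M.second μ₁)) ∧
        ∀ Ainf μ₁ μ₂ h₀ : ℝ, A < Ainf → z₀ < μ₁ → M.Q μ₁ = M.V A (M.second μ₁) →
          μ₂ = M.second μ₁ →
          (M.B - M.C) / (Ainf - M.B) * √(M.k₂ * M.c₂ / (M.k₃ * M.c₃)) *
              (1 / ThreePhase.erf (z₀ * √(M.α₁ / M.α₂))) <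
            (A - M.B) / ((Ainf - A) * ThreePhase.erf (μ₂ * √(M.α₁ / M.α₃))) →
          h₀ = M.k₃ / √(M.α₃ * π) * ((A - M.B) / (Ainf - A)) *
              (1 / ThreePhase.erf (μ₂ * √(M.α₁ / M.α₃))) →
          M.IsTheSolutionP2 A (M.dirichletSolution A μ₁ μ₂) ∧
          M.IsTheSolutionP1 h₀ Ainf (M.dirichletSolution A μ₁ μ₂)) := by
  open ThreePhase Data in
  refine ⟨M.existsUnique_zero_H, fun z₀ hz₀ hH => ⟨fun h Ainf hA hh => ?_, fun A hA => ?_⟩⟩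
  · have hh0 := (h₂_pos hz₀ hA).trans hh
    have hK : 0 ≤ M.k₃ / (h * √(π * M.α₃)) :=
      div_nonneg M.k₃_pos.le (mul_nonneg hh0.le (Real.sqrt_nonneg _))
    simp only [U, T_eq_W]
    refine ⟨existsUnique_root hz₀ hH hK (Q_zero_mul_lt hz₀ hH hA hh), ?_⟩
    rintro ξ _ A hξ hQ rfl hAeq hAB
    have hs := second_pos hz₀ hH hξ
    have hd := add_erf_pos (M := M) hK hs
    rw [robinSolution_eq_profile (second_lt hz₀ hH hξ.le) hd]
    have hP : (Ainf - M.B) / (M.k₃ / (h * √(π * M.α₃)) + erf (M.second ξ * √(M.α₁ / M.α₃))) *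
        (M.k₃ / (h * √(π * M.α₃)) + erf (M.second ξ * √(M.α₁ / M.α₃))) = Ainf - M.B :=
      div_mul_cancel₀ _ hd.ne'
    -- `A` is the face temperature of this very profile, so its slope satisfies the Dirichlet
    -- equation.
    have hP' : (Ainf - M.B) / (M.k₃ / (h * √(π * M.α₃)) + erf (M.second ξ * √(M.α₁ / M.α₃))) *
        (0 + erf (M.second ξ * √(M.α₁ / M.α₃))) = A - M.B := by
      rw [hAeq, wallTemperature, mul_div_assoc M.B]
      generalize M.k₃ / (h * √(π * M.α₃)) = K at hd ⊢
      field_simp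
      ring
    exact ⟨isTheSolutionP1_profile hz₀ hH hξ hA hh0 hP hQ,
      isTheSolutionP2_profile hz₀ hH hξ hAB hP'
        ((eq_W_iff le_rfl hs hP').2 ((eq_W_iff hK hs hP).1 hQ))⟩
  · simp only [V_eq_W]
    refine ⟨existsUnique_root hz₀ hH le_rfl
      (by rw [mul_zero]; exact mul_pos M.coeffW_pos (sub_pos.2 hA)), ?_⟩
    rintro Ainf μ _ h hAA hμ hQ rfl - hheq
    have hs := second_pos hz₀ hH hμ
    have hE := erf_pos (mul_pos hs M.ratio₃_pos)
    have hAB := sub_pos.2 hA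
    have hAA' := sub_pos.2 hAA
    have hk3 := M.k₃_pos
    have h3 : 0 < √(M.α₃ * π) := Real.sqrt_pos.2 (mul_pos M.α₃_pos Real.pi_pos)
    have hh0 : 0 < h := by
      rw [hheq]
      positivity
    have hK : 0 ≤ M.k₃ / (h * √(π * M.α₃)) :=
      div_nonneg M.k₃_pos.le (mul_nonneg hh0.le (Real.sqrt_nonneg _))
    rw [dirichletSolution_eq_profile hs (second_lt hz₀ hH hμ.le)]
    have hP : (A - M.B) / erf (M.second μ * √(M.α₁ / M.α₃)) *
        (0 + erf (M.second μ * √(M.α₁ / M.α₃))) = A - M.B := by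
      rw [zero_add, div_mul_cancel₀ _ hE.ne']
    -- The choice of `h` gives `P * K = A∞ - A`; adding `P * erf (μ₂ √(α₁/α₃)) = A - B` yields the
    -- Robin equation.
    have hP' : (A - M.B) / erf (M.second μ * √(M.α₁ / M.α₃)) *
        (M.k₃ / (h * √(π * M.α₃)) + erf (M.second μ * √(M.α₁ / M.α₃))) = Ainf - M.B := by
      rw [hheq, mul_comm π]
      field_simp
      ring
    exact ⟨isTheSolutionP2_profile hz₀ hH hμ hA hP hQ,
      isTheSolutionP1_profile hz₀ hH hμ (hA.trans hAA) hh0 hP'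
        ((eq_W_iff hK hs hP').2 ((eq_W_iff le_rfl hs hP).1 hQ))⟩
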